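/- Let $p$ be a prime. All rings are commutative. A ring $A$ of characteristic $p$ is F-finite if it is a finitely generated module over its subring $A^p$ of $p$-th powers. We say that $A$ has Frobenius splittings if for every $f\in A$ not contained in any minimal prime there are $e\ge 1$ and $\phi\in\operatorname{Hom}_A(F^e_*A,A)$ with $\phi(F^e_*f)=1$, where $F^e_*A$ is $A$ viewed as an $A$-module through the $e$-th iterate of Frobenius; $A$ is strongly F-regular if it is Noetherian, F-finite and has Frobenius splittings. A ring is normal if all its localizations at primes are integrally closed domains. Cohen--Macaulay and regular rings are Noetherian, and both properties are defined through the localizations at primes. (1) Let $R\to S$ be a homomorphism of rings of characteristic $p$ that splits in the category of $R$-modules, i.e. there is an $R$-linear map $\varphi:S\to R$ with $\varphi(1)=1$ (so $R\subset S$ is a direct summand). If $S$ is regular, then $R$ is Cohen--Macaulay and normal. If moreover $S$ is F-finite, then $R$ has Frobenius splittings; hence, if $R$ is F-finite as well, $R$ is strongly F-regular. (2) Let $k$ be a field and let $G$ be a linearly reductive affine algebraic group over $k$, i.e. an affine group scheme of finite type over $k$ all of whose finite-dimensional representations are direct sums of irreducible ones. Let $G$ act (rationally, by $k$-algebra automorphisms)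 on a regular Noetherian $k$-algebra $S$ of characteristic $p$. Let $S^G\subset S$ be the ring of invariants, i.e. the set of $s\in S$ with $\rho(s)=s\otimes 1$, where $\rho:S\to S\otimes_k k[G]$ is the coaction. Then $S^G$ is Cohen--Macaulay and normal. If moreover $S$ is F-finite, then $S^G$ has Frobenius splittings; hence, if $S^G$ is F-finite as well, $S^G$ is strongly F-regular. -/

import Mathlib

open scoped TensorProduct

universe u

/-! ### F-finiteness and strong F-regularity -/

/-- A ring `R` of characteristic `p` is F-finite if the Frobenius `r ↦ r ^ p` is a finite ring map,
i.e. if `R` is a finitely generated module over its subring of `p`-th powers. -/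
def IsFFinite (p : ℕ) (R : Type*) [CommRing R] [ExpChar R p] : Prop :=
  (frobenius R p).Finite

/-- There are `e ≥ 1` and an `R`-linear map `φ : F^e_* R → R` with `φ (F^e_* f) = 1`.
Here `F^e_* R` is the additive group `R` on which `r : R` acts as multiplication by `r ^ p ^ e`,
so an `R`-linear map from it is an additive `φ : R → R` with `φ (r ^ p ^ e * x) = r * φ x`. -/
def SplitsAlong (p : ℕ) (R : Type*) [CommRing R] (f : R) : Prop :=
  ∃ e : ℕ, 0 < e ∧ ∃ φ : R →+ R, (∀ r x : R, φ (r ^ p ^ e * x) = r * φ x) ∧ φ f = 1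

/-- Frobenius splits along every element that lies in no minimal prime
(along every nonzero element, if `R` is a domain). -/
def HasFrobeniusSplittings (p : ℕ) (R : Type*) [CommRing R] : Prop :=
  ∀ f : R, (∀ P ∈ minimalPrimes R, f ∉ P) → SplitsAlong p R f

/-- Strongly F-regular rings: Noetherian F-finite rings in which some iterate of Frobenius splits
along every element outside the minimal primes. -/
structure IsStronglyFRegular (p : ℕ) (R : Type*) [CommRing R] [ExpChar R p] : Prop where
  isNoetherianRing : IsNoetherianRing R
  isFFinite : IsFFinite p R
  splittings : HasFrobeniusSplittings p R

/-! ### Cohen-Macaulay rings and normal rings -/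

/-- A Noetherian local ring is Cohen-Macaulay if it admits a regular sequence whose length is the
Krull dimension. -/
structure IsCohenMacaulayLocalRing (A : Type*) [CommRing A] : Prop where
  isLocalRing : IsLocalRing A
  isNoetherianRing : IsNoetherianRing A
  exists_isRegular : ∃ rs : List A,
    RingTheory.Sequence.IsRegular A rs ∧ (rs.length : WithBot ℕ∞) = ringKrullDim A

/-- A Noetherian ring is Cohen-Macaulay if all its localizations at primes are. -/
structure IsCohenMacaulayRing (R : Type*) [CommRing R] : Prop where
  isNoetherianRing : IsNoetherianRing R
  localization : ∀ (P : Ideal R) [P.IsPrime],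
    IsCohenMacaulayLocalRing (Localization.AtPrime P)

/-- A ring is normal if all its localizations at primes are integrally closed domains. -/
def IsNormalRing (R : Type*) [CommRing R] : Prop :=
  ∀ (P : Ideal R) [P.IsPrime],
    IsDomain (Localization.AtPrime P) ∧ IsIntegrallyClosed (Localization.AtPrime P)

/-! ### Representations of affine group schemes

An affine algebraic group `G` over a field `k` is given by its coordinate ring `H`, a commutative
Hopf algebra of finite type over `k`; a representation of `G` is a right `H`-comodule. -/

/-- `ρ` makes `V` into a right comodule over `H`. -/
structure IsCoaction (k H V : Type*) [Field k] [CommRing H] [HopfAlgebra k H]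
    [AddCommGroup V] [Module k V] (ρ : V →ₗ[k] V ⊗[k] H) : Prop where
  coassoc : (TensorProduct.assoc k V H H).toLinearMap ∘ₗ ρ.rTensor H ∘ₗ ρ =
    (Coalgebra.comul (R := k) (A := H)).lTensor V ∘ₗ ρ
  counit : (TensorProduct.rid k V).toLinearMap ∘ₗ
    (Coalgebra.counit (R := k) (A := H)).lTensor V ∘ₗ ρ = LinearMap.id

/-- `W` is a subrepresentation: `ρ` maps `W` into (the image of) `W ⊗ H`. -/
def IsSubrep {k H V : Type*} [Field k] [CommRing H] [HopfAlgebra k H]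
    [AddCommGroup V] [Module k V] (ρ : V →ₗ[k] V ⊗[k] H) (W : Submodule k V) : Prop :=
  ∀ w ∈ W, ρ w ∈ LinearMap.range (W.subtype.rTensor H)

/-- `W` is an irreducible subrepresentation. -/
structure IsIrreducibleSubrep {k H V : Type*} [Field k] [CommRing H] [HopfAlgebra k H]
    [AddCommGroup V] [Module k V] (ρ : V →ₗ[k] V ⊗[k] H) (W : Submodule k V) : Prop where
  isSubrep : IsSubrep ρ W
  ne_bot : W ≠ ⊥
  eq_bot_or_eq : ∀ U ≤ W, IsSubrep ρ U → U = ⊥ ∨ U = W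

/-- The affine algebraic group with coordinate ring `H` is linearly reductive: every
finite-dimensional representation is a direct sum of irreducible ones. -/
structure IsLinearlyReductive (k : Type u) (H : Type*) [Field k] [CommRing H]
    [HopfAlgebra k H] : Prop where
  finiteType : Algebra.FiniteType k H
  completelyReducible : ∀ (V : Type u) [AddCommGroup V] [Module k V] [FiniteDimensional k V]
    (ρ : V →ₗ[k] V ⊗[k] H), IsCoaction k H V ρ →
      ∃ (n : ℕ) (W : Fin n → Submodule k V),
        (∀ i, IsIrreducibleSubrep ρ (W i)) ∧ iSupIndep W ∧ ⨆ i, W i = ⊤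

/-- The ring of invariants of the action of `G` on the `k`-algebra `S` given by the coaction `ρ`:
the elements `s` with `ρ s = s ⊗ 1`, i.e. those fixed by all points of `G` with values in
`k`-algebras. -/
def invariantRing {k H S : Type*} [Field k] [CommRing H] [HopfAlgebra k H] [CommRing S]
    [Algebra k S] (ρ : S →ₐ[k] S ⊗[k] H) : Subalgebra k S :=
  AlgHom.equalizer ρ Algebra.TensorProduct.includeLeft

instance invariantRing.charP {k H S : Type*} [Field k] [CommRing H] [HopfAlgebra k H] [CommRing S]
    [Algebra k S] (ρ : S →ₐ[k] S ⊗[k] H) (p : ℕ) [CharP S p] : CharP (invariantRing ρ) p :=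
  (algebraMap (invariantRing ρ) S).charP Subtype.val_injective p

/-!
The theorem combines a reduction to complete local rings, the strong F-regularity of power series
rings, and the Reynolds operator.

*Purity.* Let `R → S` be split by `φ` and let `P` be a prime of `R`. The elements `s` with
`φ (s S) ⊆ P` form an ideal contracting to `P`, so it is contained in a prime `n` over `P` such that
`φ (s S) ⊄ P` for all `s ∉ n` (`exists_prime_of_split`). Hence `R_P → S_n` is cyclically pure, and so
is its composition with `S_n → C`, where `C` is the completion of `S_n`
(`exists_cyclicallyPure_completion_of_split`). By Cohen's theorem (`exists_coefficientField`), `C` is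
a power series ring over a field. For each `c ≠ 0` in it and each large `e` there is a map
`F^e_* C → C` with `c ↦ 1`: it extracts the coefficients at the exponents congruent to a suitable one
modulo `p ^ e` (`MvPowerSeries.exists_frobenius_splitting`). This needs no finiteness of the field.

*Normality.* If `a / b` is integral over `R_P`, then `c a ^ n ∈ (b ^ n)` for some `c ≠ 0` and all `n`.
Taking `n = p ^ e` and applying a splitting along `c` gives `a ∈ b C`, hence `a ∈ (b)` by purity
(`IsCyclicallyPure.isIntegrallyClosed`).

*Cohen-Macaulayness.* A system of parameters `x` of `R_P` makes the completion of `R_P` a finite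
algebra over a power series ring `A` in the variables `x`
(`IsMaximalAdicCompletion.exists_noether_normalization`). Up to a multiplier `c ≠ 0` in `A` this
algebra embeds in a free `A`-module, so relations among the powers `x_i ^ q` become trivial after
multiplication by `c`, with `c` independent of `q` (`MvPowerSeries.exists_colon_capturing`). The
multiplier stays nonzero in `C` because `A → C` is injective: `x` is analytically independent, and
by purity the completion of `R_P` embeds in `C`. A splitting along `c` then removes it
(`IsCyclicallyPure.isCohenMacaulayLocalRing`).

*Frobenius splittings.* If `S` is F-finite, then a map `F^e_* S → C` is congruent to one into `S_n`
modulo the maximal ideal, by the Artin-Rees lemma, and clearing a denominator turns this into a map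
`F^e_* S → S` with value outside `n`. Composed with `φ (t ·)` for a suitable `t` it gives a map
`F^e_* R → R` with value outside `P` (`exists_notMem_frobeniusTraceIdeal`). The values at `f` of all
maps `F^e_* R → R` form an ideal, and these ideals increase with `e` since Frobenius splits on `R`;
as no maximal ideal contains their union, one of them contains `1`.

*Invariants.* For a linearly reductive group, `S` is the direct sum of `S^G` and the sum `N` of the
finite-dimensional subrepresentations without nonzero invariant linear forms
(`IsLinearlyReductive.isCompl_nonInvariantPart`). Multiplication by an invariant is equivariant, so
`N` is an `S^G`-submodule, and the projection along `N` splits `S^G → S`.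
-/

/-! ### Coefficient fields in characteristic `p` -/

/-- If every element of the maximal ideal `J` has `p`-th power zero, then `B` contains a subring
that maps bijectively onto the field `B ⧸ J`: a subring maximal among those that contain all `p`-th
powers and meet `J` trivially. -/
theorem exists_subring_isCompl_of_frobenius_zero (p : ℕ) [Fact p.Prime] {B : Type*} [CommRing B]
    [CharP B p] (J : Ideal B) [J.IsMaximal] (hJ : ∀ x ∈ J, x ^ p = 0) :
    ∃ K : Subring B, (∀ x ∈ K, x ∈ J → x = 0) ∧ ∀ b : B, ∃ x ∈ K, b - x ∈ J := by
  have hp : p.Prime := Fact.out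
  let Z : Set (Subring B) := {K | (frobenius B p).range ≤ K ∧ ∀ x ∈ K, x ∈ J → x = 0}
  have h0 : (frobenius B p).range ∈ Z := by
    refine ⟨le_rfl, ?_⟩
    rintro _ ⟨b, rfl⟩ hb
    exact hJ b ((inferInstance : J.IsPrime).mem_of_pow_mem p hb)
  obtain ⟨K, -, hK⟩ := zorn_le_nonempty₀ Z (by
    intro c hcZ hc y hy
    refine ⟨sSup c, ⟨(hcZ hy).1.trans (le_sSup hy), ?_⟩, fun z hz => le_sSup hz⟩
    intro x hx hxJ
    obtain ⟨s, hs, hxs⟩ := (Subring.mem_sSup_of_directedOn ⟨y, hy⟩ hc.directedOn).1 hx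
    exact (hcZ hs).2 x hxs hxJ) _ h0
  have hpow : ∀ b : B, b ^ p ∈ K := fun b => hK.prop.1 ⟨b, rfl⟩
  refine ⟨K, hK.prop.2, ?_⟩
  by_contra! hcon
  obtain ⟨b, hb⟩ := hcon
  have hunit : ∀ x ∈ K, x ≠ 0 → ∃ y ∈ K, x * y = 1 := by
    intro x hx hx0
    have hxJ : x ∉ J := fun h => hx0 (hK.prop.2 x hx h)
    obtain ⟨y, hy⟩ := Ideal.Quotient.exists_inv (I := J) (a := Ideal.Quotient.mk J x)
      (by rwa [Ne, Ideal.Quotient.eq_zero_iff_mem])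
    obtain ⟨y, rfl⟩ := Ideal.Quotient.mk_surjective y
    have h1 : x * y - 1 ∈ J := by
      rw [← Ideal.Quotient.eq_zero_iff_mem, map_sub, map_mul, hy, map_one, sub_self]
    have h2 := hJ _ h1
    rw [sub_pow_char, one_pow, sub_eq_zero, mul_pow] at h2
    refine ⟨x ^ (p - 1) * y ^ p, K.mul_mem (K.pow_mem hx _) (hpow y), ?_⟩
    rw [← mul_assoc, ← pow_succ', Nat.sub_add_cancel hp.one_le, h2]
  have : Nontrivial B := CharP.nontrivial_of_char_ne_one hp.ne_one
  have hfield : IsField K := by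
    refine ⟨⟨0, 1, zero_ne_one⟩, mul_comm, ?_⟩
    intro a ha
    obtain ⟨y, hy, h⟩ := hunit a a.2 (by simpa using ha)
    exact ⟨⟨y, hy⟩, Subtype.ext h⟩
  let := hfield.toField
  let : Field (B ⧸ J) := Ideal.Quotient.field J
  let : Algebra K (B ⧸ J) := ((Ideal.Quotient.mk J).comp K.subtype).toAlgebra
  let c : K := ⟨b ^ p, hpow b⟩
  -- an element `b` outside `K + J` has degree `p` over `K` modulo `J`, so adjoining it to `K` gives a
  -- larger such ring
  have hirr : Irreducible (Polynomial.X ^ p - Polynomial.C c) := by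
    refine X_pow_sub_C_irreducible_of_prime hp fun k hk => hb k k.2 ?_
    have h1 : (k : B) ^ p = b ^ p := congrArg Subtype.val hk
    have : (b - k) ^ p = 0 := by rw [sub_pow_char, h1, sub_self]
    exact (inferInstance : J.IsPrime).mem_of_pow_mem p (this ▸ J.zero_mem)
  have hmonic : (Polynomial.X ^ p - Polynomial.C c).Monic :=
    Polynomial.monic_X_pow_sub_C c hp.ne_zero
  have hmin : minpoly K (Ideal.Quotient.mk J b) = Polynomial.X ^ p - Polynomial.C c := by
    refine (minpoly.eq_of_irreducible_of_monic hirr ?_ hmonic).symm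
    simp only [map_sub, map_pow, Polynomial.aeval_X, Polynomial.aeval_C]
    rw [sub_eq_zero]; rfl
  let g : Polynomial K →+* B := Polynomial.eval₂RingHom K.subtype b
  have hgC : ∀ k : K, g (Polynomial.C k) = k := fun k => by simp [g]
  have hgX : g Polynomial.X = b := by simp [g]
  have hL : g.range ∈ Z := by
    refine ⟨fun x hx => ⟨Polynomial.C ⟨x, hK.prop.1 hx⟩, hgC _⟩, ?_⟩
    rintro _ ⟨f, rfl⟩ hf
    have hdiv := Polynomial.modByMonic_add_div f (Polynomial.X ^ p - Polynomial.C c)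
    have hg0 : g (Polynomial.X ^ p - Polynomial.C c) = 0 := by
      rw [map_sub, map_pow, hgX, hgC, sub_self]
    set r := f %ₘ (Polynomial.X ^ p - Polynomial.C c) with hr
    have hfr : g f = g r := by rw [← hdiv, map_add, map_mul, hg0, zero_mul, add_zero]
    have hcomp : ∀ q : Polynomial K, Polynomial.aeval (Ideal.Quotient.mk J b) q
        = Ideal.Quotient.mk J (g q) := by
      intro q
      simp only [g, Polynomial.aeval_def, Polynomial.coe_eval₂RingHom, Polynomial.hom_eval₂]
      rfl
    have hr0 : r = 0 := by
      by_contra hne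
      have h1 := minpoly.degree_le_of_ne_zero K (Ideal.Quotient.mk J b) hne
        (by rw [hcomp, ← hfr]; exact Ideal.Quotient.eq_zero_iff_mem.2 hf)
      rw [hmin] at h1
      exact absurd (Polynomial.degree_modByMonic_lt f hmonic) (not_lt.2 h1)
    rw [hfr, hr0, map_zero]
  have hle : K ≤ g.range := fun x hx => ⟨Polynomial.C ⟨x, hx⟩, hgC _⟩
  have hbK : b ∈ K := hK.le_of_ge hL hle ⟨Polynomial.X, hgX⟩
  exact hb b hbK (by simp)

/-- Every field of characteristic `p` is formally smooth over the prime field, with no finiteness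
assumption. -/
theorem formallySmooth_zmod_field (p : ℕ) [Fact p.Prime] (k : Type*) [Field k]
    [Algebra (ZMod p) k] : Algebra.FormallySmooth (ZMod p) k := by
  have hp : p.Prime := Fact.out
  apply Algebra.FormallySmooth.of_comp_surjective
  intro B _ _ I hI f
  rcases subsingleton_or_nontrivial (B ⧸ I) with hs | hn
  · have hI' : I = ⊥ := by
      have : I = ⊤ := Ideal.Quotient.subsingleton_iff.1 hs
      rw [this, pow_two, Ideal.top_mul] at hI
      rw [this, hI]
    subst hI'
    exact ⟨(AlgEquiv.quotientBot (ZMod p) B).toAlgHom.comp f, by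
      ext x; exact Subsingleton.elim _ _⟩
  have : Nontrivial B := (Ideal.Quotient.mk I).domain_nontrivial
  have : CharP B p := charP_of_injective_algebraMap (algebraMap (ZMod p) B).injective p
  have hf : Function.Injective f := f.toRingHom.injective
  let C : Subalgebra (ZMod p) B := f.range.comap (Ideal.Quotient.mkₐ (ZMod p) I)
  have : CharP C p := (algebraMap C B).charP Subtype.val_injective p
  let h : C →ₐ[ZMod p] f.range :=
    ((Ideal.Quotient.mkₐ (ZMod p) I).comp C.val).codRestrict f.range fun x => x.2
  let e : k ≃ₐ[ZMod p] f.range := AlgEquiv.ofInjective f hf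
  let g : C →ₐ[ZMod p] k := e.symm.toAlgHom.comp h
  have hg : ∀ x : C, f (g x) = Ideal.Quotient.mk I x.1 := by
    intro x
    have h1 : e (g x) = h x := e.apply_symm_apply _
    exact congrArg Subtype.val h1
  have hgs : Function.Surjective g := by
    intro a
    obtain ⟨b, hb⟩ := Ideal.Quotient.mk_surjective (f a)
    refine ⟨⟨b, ⟨a, hb.symm⟩⟩, hf ?_⟩
    rw [hg, hb]
  let J : Ideal C := RingHom.ker g.toRingHom
  have : J.IsMaximal := RingHom.ker_isMaximal_of_surjective g.toRingHom hgs
  have hJ : ∀ x ∈ J, x ^ p = 0 := by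
    intro x hx
    have h1 : x.1 ∈ I := by
      rw [← Ideal.Quotient.eq_zero_iff_mem, ← hg, show g x = 0 from hx, map_zero]
    have h2 : x.1 ^ 2 = 0 := by
      have : x.1 ^ 2 ∈ I ^ 2 := Ideal.pow_mem_pow h1 2
      rwa [hI] at this
    refine Subtype.ext ?_
    change x.1 ^ p = 0
    exact pow_eq_zero_of_le hp.two_le h2
  obtain ⟨K, hK0, hK1⟩ := exists_subring_isCompl_of_frobenius_zero p J hJ
  let gK : K →+* k := g.toRingHom.comp K.subtype
  have hgK : Function.Bijective gK := by
    refine ⟨(injective_iff_map_eq_zero _).2 fun x hx => Subtype.ext (hK0 x x.2 hx), fun a => ?_⟩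
    obtain ⟨b, rfl⟩ := hgs a
    obtain ⟨x, hx, hbx⟩ := hK1 b
    refine ⟨⟨x, hx⟩, ?_⟩
    have : g b - g x = 0 := by rw [← map_sub]; exact hbx
    exact (sub_eq_zero.1 this).symm
  let s : k →+* B := (C.val.toRingHom.comp K.subtype).comp
    (RingEquiv.ofBijective gK hgK).symm.toRingHom
  refine ⟨{ s with commutes' := fun r => congrFun (congrArg DFunLike.coe
    (Subsingleton.elim (s.comp (algebraMap (ZMod p) k)) (algebraMap (ZMod p) B))) r }, ?_⟩
  ext a
  have h1 : gK ((RingEquiv.ofBijective gK hgK).symm a) = a :=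
    (RingEquiv.ofBijective gK hgK).apply_symm_apply a
  have h2 := hg ((RingEquiv.ofBijective gK hgK).symm a : K).1
  change Ideal.Quotient.mk I (s a) = f a
  exact h2.symm.trans (congrArg f h1)

/-- **Cohen's theorem** in equal characteristic `p`: a ring of characteristic `p` that is complete
with respect to a maximal ideal contains a coefficient field. -/
theorem exists_coefficientField (p : ℕ) [Fact p.Prime] {B : Type*} [CommRing B] [CharP B p]
    (J : Ideal B) [J.IsMaximal] [IsAdicComplete J B] :
    ∃ s : (B ⧸ J) →+* B, ∀ a, Ideal.Quotient.mk J (s a) = a := by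
  let : Algebra (ZMod p) B := ZMod.algebra B p
  let : Field (B ⧸ J) := Ideal.Quotient.field J
  have := formallySmooth_zmod_field p (B ⧸ J)
  obtain ⟨g, hg⟩ := Algebra.FormallySmooth.exists_mkₐ_comp_eq_of_isAdicComplete
    (I := J) (AlgHom.id (ZMod p) (B ⧸ J))
  exact ⟨g.toRingHom, fun a => congrArg (fun h => h a) hg⟩

/-! ### Completions of local rings -/

open IsLocalRing in
/-- `B` is the completion of the local ring `R` at its maximal ideal, up to isomorphism: it is
complete for the extended ideal, `R` carries the induced topology, and `R` is dense. -/
structure IsMaximalAdicCompletion (R B : Type*) [CommRing R] [IsLocalRing R] [CommRing B]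
    [Algebra R B] : Prop where
  isAdicComplete : IsAdicComplete ((maximalIdeal R).map (algebraMap R B)) B
  mem_pow : ∀ (n : ℕ) (r : R),
    algebraMap R B r ∈ (maximalIdeal R).map (algebraMap R B) ^ n → r ∈ maximalIdeal R ^ n
  dense : ∀ (n : ℕ) (b : B), ∃ r : R,
    b - algebraMap R B r ∈ (maximalIdeal R).map (algebraMap R B) ^ n

open IsLocalRing in
theorem isMaximalAdicCompletion_adicCompletion (R : Type*) [CommRing R] [IsLocalRing R]
    [IsNoetherianRing R] :
    IsMaximalAdicCompletion R (AdicCompletion (maximalIdeal R) R) := by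
  have hfg : (maximalIdeal R).FG := (maximalIdeal R).fg_of_isNoetherianRing
  have key : ∀ (n : ℕ) (b : AdicCompletion (maximalIdeal R) R),
      b ∈ (maximalIdeal R).map (algebraMap R (AdicCompletion (maximalIdeal R) R)) ^ n ↔
        AdicCompletion.eval (maximalIdeal R) R n b = 0 := by
    intro n b
    rw [← LinearMap.mem_ker, ← AdicCompletion.pow_smul_top_eq_ker_eval hfg,
      Ideal.smul_top_eq_map, Submodule.restrictScalars_mem, Ideal.map_pow]
  have hof : ∀ (n : ℕ) (r : R), AdicCompletion.eval (maximalIdeal R) R n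
      (algebraMap R (AdicCompletion (maximalIdeal R) R) r) =
        Submodule.mkQ (maximalIdeal R ^ n • ⊤ : Submodule R R) r := by
    intro n r
    rw [AdicCompletion.algebraMap_apply, AdicCompletion.eval_of]
    rfl
  refine ⟨AdicCompletion.isAdicComplete_self _ hfg, fun n r h => ?_, fun n b => ?_⟩
  · rw [key, hof] at h
    rw [Submodule.mkQ_apply, Submodule.Quotient.mk_eq_zero] at h
    simpa using h
  · obtain ⟨r, hr⟩ := Submodule.mkQ_surjective _ (AdicCompletion.eval (maximalIdeal R) R n b)
    refine ⟨r, ?_⟩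
    rw [key, map_sub, hof, hr, sub_self]

/-- Evaluation of power series at topologically nilpotent elements of a complete ring. -/
theorem exists_mvPowerSeries_eval {k B : Type*} [Field k] [CommRing B] (J : Ideal B)
    [IsAdicComplete J B] (s : k →+* B) {d : ℕ} (x : Fin d → B) (hx : ∀ i, x i ∈ J) :
    ∃ θ : MvPowerSeries (Fin d) k →+* B,
      (∀ a, θ (MvPowerSeries.C a) = s a) ∧ ∀ i, θ (MvPowerSeries.X i) = x i := by
  let : TopologicalSpace B := J.adicTopology
  have hJ : IsAdic J := rfl
  have : IsTopologicalRing B := J.ringFilterBasis.isTopologicalRing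
  let : UniformSpace B := IsTopologicalAddGroup.rightUniformSpace B
  have : IsUniformAddGroup B := isUniformAddGroup_of_addCommGroup
  obtain ⟨hc, ht⟩ := hJ.isAdicComplete_iff.1 ‹IsAdicComplete J B›
  let : UniformSpace k := ⊥
  have : DiscreteTopology k := ⟨rfl⟩
  have : IsUniformAddGroup k := inferInstance
  have : IsLinearTopology B B := by
    refine IsLinearTopology.mk_of_hasBasis B (p := fun _ => True) (s := fun n : ℕ => J ^ n) ?_
    exact hJ.hasBasis_nhds_zero
  have hs : Continuous s := continuous_of_discreteTopology
  have ha : MvPowerSeries.HasEval x := by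
    refine ⟨fun i => ?_, by simp⟩
    rw [IsTopologicallyNilpotent, hJ.hasBasis_nhds_zero.tendsto_right_iff]
    intro n _
    filter_upwards [Filter.eventually_ge_atTop n] with m hm
    exact Ideal.pow_le_pow_right hm (Ideal.pow_mem_pow (hx i) m)
  refine ⟨MvPowerSeries.eval₂Hom hs ha, fun a => ?_, fun i => ?_⟩
  · rw [MvPowerSeries.coe_eval₂Hom, MvPowerSeries.eval₂_C]
  · rw [MvPowerSeries.coe_eval₂Hom, MvPowerSeries.eval₂_X]

/-! ### Power series rings over a field of characteristic `p` -/

/-- The ideal generated by the `q`-th powers of some of the variables consists of the power series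
supported on exponents that are at least `q` at one of these variables. -/
theorem MvPowerSeries.mem_span_X_pow_iff {σ k : Type*} [Field k] (s : Finset σ) (q : ℕ)
    (f : MvPowerSeries σ k) :
    f ∈ Ideal.span ((fun j => (MvPowerSeries.X j : MvPowerSeries σ k) ^ q) '' (s : Set σ)) ↔
      ∀ a : σ →₀ ℕ, (∀ j ∈ s, a j < q) → MvPowerSeries.coeff a f = 0 := by
  classical
  constructor
  · intro hf
    induction hf using Submodule.span_induction with
    | mem x hx =>
      obtain ⟨j, hj, rfl⟩ := hx
      intro a ha
      exact MvPowerSeries.X_pow_dvd_iff.1 dvd_rfl a (ha j hj)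
    | zero => simp
    | add x y _ _ hx hy =>
      intro a ha
      rw [map_add, hx a ha, hy a ha, add_zero]
    | smul b x _ hx =>
      intro a ha
      rw [smul_eq_mul, MvPowerSeries.coeff_mul]
      refine Finset.sum_eq_zero fun uv huv => ?_
      rw [hx uv.2 fun j hj => lt_of_le_of_lt ?_ (ha j hj), mul_zero]
      rw [← Finset.HasAntidiagonal.mem_antidiagonal.1 huv]
      simp
  · induction s using Finset.induction_on generalizing f with
    | empty =>
      intro h
      have : f = 0 := MvPowerSeries.ext fun a => by simpa using h a (by simp)
      rw [this]
      exact zero_mem _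
    | insert j s hj ih =>
      intro h
      let f₁ : MvPowerSeries σ k := fun a => if q ≤ a j then MvPowerSeries.coeff a f else 0
      have hf₁ : ∀ a, MvPowerSeries.coeff a f₁ =
          if q ≤ a j then MvPowerSeries.coeff a f else 0 := fun a => rfl
      have h₁ : MvPowerSeries.X j ^ q ∣ f₁ := by
        rw [MvPowerSeries.X_pow_dvd_iff]
        intro a ha
        rw [hf₁, if_neg (not_le.2 ha)]
      have h₂ := ih (f - f₁) (by
        intro a ha
        rw [map_sub, hf₁]
        split_ifs with h3
        · rw [sub_self]
        · rw [sub_zero]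
          refine h a fun i hi => ?_
          rcases Finset.mem_insert.1 hi with rfl | hi
          · exact not_le.1 h3
          · exact ha i hi)
      rw [← sub_add_cancel f f₁]
      refine Ideal.add_mem _ (Ideal.span_mono (Set.image_mono (by simp)) h₂) ?_
      exact Ideal.mem_of_dvd _ h₁ (Ideal.subset_span ⟨j, by simp, rfl⟩)

/-- Powers of the variables form a regular sequence in every order. -/
theorem MvPowerSeries.mem_span_X_pow_of_X_pow_mul_mem {σ k : Type*} [Field k] (s : Finset σ)
    (q : ℕ) {i : σ} (hi : i ∉ s) (g : MvPowerSeries σ k)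
    (h : MvPowerSeries.X i ^ q * g ∈
      Ideal.span ((fun j => (MvPowerSeries.X j : MvPowerSeries σ k) ^ q) '' (s : Set σ))) :
    g ∈ Ideal.span ((fun j => (MvPowerSeries.X j : MvPowerSeries σ k) ^ q) '' (s : Set σ)) := by
  rw [MvPowerSeries.mem_span_X_pow_iff] at h ⊢
  intro a ha
  have := h (Finsupp.single i q + a) (fun j hj => by
    have : i ≠ j := fun h => hi (h ▸ hj)
    simpa [this] using ha j hj)
  rwa [MvPowerSeries.X_pow_eq, MvPowerSeries.coeff_add_monomial_mul, one_mul] at this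

theorem MvPowerSeries.maximalIdeal_eq_span_X {σ k : Type*} [Field k] [Finite σ] :
    IsLocalRing.maximalIdeal (MvPowerSeries σ k) = Ideal.span (Set.range MvPowerSeries.X) := by
  have := Fintype.ofFinite σ
  ext f
  have h := MvPowerSeries.mem_span_X_pow_iff (Finset.univ : Finset σ) 1 f
  simp only [pow_one, Finset.coe_univ, Set.image_univ, Finset.mem_univ, true_imp_iff,
    Nat.lt_one_iff] at h
  rw [show Ideal.span (Set.range (MvPowerSeries.X : σ → MvPowerSeries σ k)) =
    Ideal.span (Set.range fun j => MvPowerSeries.X j) from rfl, h, IsLocalRing.mem_maximalIdeal,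
    mem_nonunits_iff, MvPowerSeries.isUnit_iff_constantCoeff, isUnit_iff_ne_zero, not_not,
    ← MvPowerSeries.coeff_zero_eq_constantCoeff_apply]
  constructor
  · intro h a ha
    rwa [show a = 0 from Finsupp.ext ha]
  · intro h
    exact h 0 (by simp)

/-- For a ring map `F` from a field to a field, every nonzero element `c` of the target is sent
to `1` by some map that is linear over the source. -/
theorem exists_semilinear_eq_one {K L : Type*} [Field K] [Field L] (F : K →+* L) {c : L}
    (hc : c ≠ 0) : ∃ μ : L →+ K, (∀ s t, μ (F s * t) = s * μ t) ∧ μ c = 1 := by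
  let := F.toAlgebra
  obtain ⟨f, hf⟩ := not_forall.1 (mt (Module.forall_dual_apply_eq_zero_iff K c).1 hc)
  refine ⟨((f c)⁻¹ • f).toAddMonoidHom, fun s t => ?_, ?_⟩
  · exact ((f c)⁻¹ • f).map_smul s t
  · exact inv_mul_cancel₀ hf

/-- Power series rings over a field are strongly F-regular, even if the field is not F-finite. -/
theorem MvPowerSeries.exists_frobenius_splitting (p : ℕ) [Fact p.Prime] {K : Type*} [Field K]
    [CharP K p] {d : ℕ} {c : MvPowerSeries (Fin d) K} {a : Fin d →₀ ℕ}
    (hc : MvPowerSeries.coeff a c ≠ 0) (e : ℕ) (ha : ∀ i, a i < p ^ e) :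
    ∃ Φ : MvPowerSeries (Fin d) K →+ MvPowerSeries (Fin d) K,
      (∀ g h, Φ (g ^ p ^ e * h) = g * Φ h) ∧ Φ c = 1 := by
  classical
  have hq : p ^ e ≠ 0 := pow_ne_zero _ (Fact.out : p.Prime).ne_zero
  obtain ⟨μ, hμ, hμc⟩ := exists_semilinear_eq_one (iterateFrobenius K p e) hc
  -- keep the coefficients at exponents congruent to `a` modulo `p ^ e`, and divide those exponents
  -- by `p ^ e`; the constant term of `Φ c` is `μ (coeff a c) = 1`, so `Φ c` is a unit
  let Φ : MvPowerSeries (Fin d) K →+ MvPowerSeries (Fin d) K :=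
    { toFun := fun h b => μ (MvPowerSeries.coeff (a + p ^ e • b) h)
      map_zero' := by ext b; exact μ.map_zero
      map_add' := fun x y => by ext b; exact μ.map_add _ _ }
  have hΦ : ∀ h b, MvPowerSeries.coeff b (Φ h) = μ (MvPowerSeries.coeff (a + p ^ e • b) h) :=
    fun _ _ => rfl
  have hlin : ∀ g h, Φ (g ^ p ^ e * h) = g * Φ h := by
    intro g h
    ext b
    rw [hΦ, MvPowerSeries.coeff_mul, MvPowerSeries.coeff_mul, map_sum]
    symm
    have hpow := MvPowerSeries.map_iterateFrobenius_expand p (Fact.out : p.Prime).ne_zero g e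
    have hpow₁ : ∀ m, MvPowerSeries.coeff (p ^ e • m) (g ^ p ^ e) =
        (MvPowerSeries.coeff m g) ^ p ^ e := fun m => by
      rw [← hpow, MvPowerSeries.coeff_map, MvPowerSeries.coeff_expand_smul, iterateFrobenius_def]
    have hpow₂ : ∀ m : Fin d →₀ ℕ, (∃ i, ¬ p ^ e ∣ m i) →
        MvPowerSeries.coeff m (g ^ p ^ e) = 0 := fun m ⟨i, hi⟩ => by
      rw [← hpow, MvPowerSeries.coeff_map, MvPowerSeries.coeff_expand_of_not_dvd _ _ _ hi, map_zero]
    refine Finset.sum_of_injOn (fun uv => (p ^ e • uv.1, a + p ^ e • uv.2)) ?_ ?_ ?_ ?_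
    · intro x _ y _ hxy
      obtain ⟨h₁, h₂⟩ := Prod.mk.inj hxy
      refine Prod.ext (Finsupp.ext fun i => ?_) (Finsupp.ext fun i => ?_)
      · simpa [(Fact.out : p.Prime).ne_zero] using DFunLike.congr_fun h₁ i
      · simpa [(Fact.out : p.Prime).ne_zero] using DFunLike.congr_fun h₂ i
    · intro x hx
      rw [Finset.mem_coe, Finset.HasAntidiagonal.mem_antidiagonal] at hx ⊢
      rw [← hx, smul_add, add_left_comm]
    · intro x hx hx'
      rw [Finset.HasAntidiagonal.mem_antidiagonal] at hx
      by_cases hdvd : ∀ i, p ^ e ∣ x.1 i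
      · choose u hu using hdvd
        have hi : ∀ i, x.1 i + x.2 i = a i + p ^ e * b i := fun i => by
          simpa using DFunLike.congr_fun hx i
        have hub : ∀ i, u i ≤ b i := by
          intro i
          by_contra hlt
          have h1 : p ^ e * (b i + 1) ≤ p ^ e * u i := Nat.mul_le_mul_left _ (not_le.1 hlt)
          have h2 := hi i
          have h3 := ha i
          rw [hu i] at h2
          rw [Nat.mul_add, Nat.mul_one] at h1
          omega
        refine absurd ⟨(Finsupp.equivFunOnFinite.symm u,
          Finsupp.equivFunOnFinite.symm fun i => b i - u i), ?_, ?_⟩ hx'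
        · rw [Finset.mem_coe, Finset.HasAntidiagonal.mem_antidiagonal]
          ext i
          simpa using Nat.add_sub_cancel' (hub i)
        · refine Prod.ext (Finsupp.ext fun i => ?_) (Finsupp.ext fun i => ?_)
          · simpa using (hu i).symm
          · have h2 := hi i
            have h4 : p ^ e * (b i - u i) + p ^ e * u i = p ^ e * b i := by
              rw [← Nat.mul_add, Nat.sub_add_cancel (hub i)]
            rw [hu i] at h2
            simp only [Finsupp.coe_add, Finsupp.coe_smul, Pi.add_apply, Pi.smul_apply, smul_eq_mul,
              Finsupp.equivFunOnFinite_symm_apply_apply]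
            omega
      · rw [hpow₂ _ (not_forall.1 hdvd), zero_mul, map_zero]
    · intro x hx
      rw [hΦ, ← hμ, iterateFrobenius_def, hpow₁]
  have hunit : IsUnit (Φ c) := by
    rw [MvPowerSeries.isUnit_iff_constantCoeff, ← MvPowerSeries.coeff_zero_eq_constantCoeff_apply,
      hΦ, smul_zero, add_zero, hμc]
    exact isUnit_one
  obtain ⟨u, hu⟩ := hunit
  refine ⟨Φ.comp (AddMonoidHom.mulLeft ((↑u⁻¹ : MvPowerSeries (Fin d) K) ^ p ^ e)), ?_, ?_⟩
  · intro g h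
    simp only [AddMonoidHom.comp_apply, AddMonoidHom.coe_mulLeft]
    rw [mul_left_comm, hlin]
  · simp only [AddMonoidHom.comp_apply, AddMonoidHom.coe_mulLeft]
    rw [hlin, ← hu, Units.inv_mul]

/-! ### Noether normalization of complete local rings -/

theorem isPrecomplete_pi {A ι : Type*} [CommRing A] (I : Ideal A) [IsPrecomplete I A] [Finite ι] :
    IsPrecomplete I (ι → A) := by
  classical
  have := Fintype.ofFinite ι
  refine ⟨fun f hf => ?_⟩
  have h1 : ∀ i, ∃ L : A, ∀ n, f n i ≡ L [SMOD (I ^ n • ⊤ : Submodule A A)] := by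
    intro i
    refine IsPrecomplete.prec ‹_› (f := fun n => f n i) fun {m n} hmn => ?_
    refine ((hf hmn).map (LinearMap.proj i : (ι → A) →ₗ[A] A)).mono ?_
    rw [Submodule.map_smul'']
    exact Submodule.smul_mono le_rfl le_top
  choose L hL using h1
  refine ⟨L, fun n => ?_⟩
  rw [SModEq.sub_mem]
  rw [show f n - L = ∑ i, (f n i - L i) • (Pi.single i (1 : A) : ι → A) by
    ext j; simp [Finset.sum_apply, Pi.single_apply]]
  refine Submodule.sum_mem _ fun i _ => Submodule.smul_mem_smul ?_ trivial
  have := SModEq.sub_mem.1 (hL i n)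
  simpa using this

theorem IsHausdorff.of_ideal_le {B : Type*} [CommRing B] {I J : Ideal B} (h : I ≤ J)
    [IsHausdorff J B] : IsHausdorff I B := by
  refine ⟨fun x hx => IsHausdorff.haus ‹IsHausdorff J B› x fun n => (hx n).mono ?_⟩
  exact Submodule.smul_mono_left (Ideal.pow_right_mono h n)

/-- If `A` surjects onto `B ⧸ J`, then every `B ⧸ J ^ n` is a finite `A`-module. -/
theorem exists_finset_span_dense {A B : Type*} [CommRing A] [CommRing B] [Algebra A B] (J : Ideal B)
    (hfg : J.FG) (hA : ∀ b : B, ∃ a : A, b - algebraMap A B a ∈ J) (n : ℕ) :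
    ∃ E : Finset B, ∀ b : B, ∃ b' ∈ Submodule.span A (E : Set B), b - b' ∈ J ^ n := by
  classical
  induction n with
  | zero => exact ⟨∅, fun b => ⟨0, zero_mem _, by simp⟩⟩
  | succ n ih =>
    obtain ⟨E, hE⟩ := ih
    obtain ⟨H, hH⟩ := hfg.pow (n := n)
    have hH' : ∀ c ∈ J ^ n, ∃ b' ∈ Submodule.span A (H : Set B), c - b' ∈ J ^ (n + 1) := by
      intro c hc
      rw [← hH] at hc
      induction hc using Submodule.span_induction with
      | mem x hx => exact ⟨x, Submodule.subset_span hx, by simp⟩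
      | zero => exact ⟨0, zero_mem _, by simp⟩
      | add x y _ _ hx hy =>
        obtain ⟨x', hx', hx⟩ := hx
        obtain ⟨y', hy', hy⟩ := hy
        exact ⟨x' + y', add_mem hx' hy', by rw [add_sub_add_comm]; exact add_mem hx hy⟩
      | smul b x hxs hx =>
        obtain ⟨x', hx', hx⟩ := hx
        obtain ⟨a, ha⟩ := hA b
        refine ⟨a • x', Submodule.smul_mem _ _ hx', ?_⟩
        have hxJ : x ∈ J ^ n := hH ▸ hxs
        rw [smul_eq_mul, Algebra.smul_def, show b * x - algebraMap A B a * x' =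
          x * (b - algebraMap A B a) + algebraMap A B a * (x - x') by ring]
        refine add_mem ?_ (Ideal.mul_mem_left _ _ hx)
        rw [pow_succ]
        exact Ideal.mul_mem_mul hxJ ha
    refine ⟨E ∪ H, fun b => ?_⟩
    obtain ⟨b', hb', h1⟩ := hE b
    obtain ⟨b'', hb'', h2⟩ := hH' _ h1
    refine ⟨b' + b'', add_mem (Submodule.span_mono (by simp) hb')
      (Submodule.span_mono (by simp) hb''), ?_⟩
    rwa [← sub_sub]

/-- The complete version of Nakayama's lemma, in the form used for Noether normalization. -/
theorem Module.finite_of_isAdicComplete {A B : Type*} [CommRing A] [CommRing B] [Algebra A B]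
    (I : Ideal A) [IsAdicComplete I A] (J : Ideal B) [IsHausdorff J B] (hfg : J.FG)
    (hA : ∀ b : B, ∃ a : A, b - algebraMap A B a ∈ J)
    (hIJ : I.map (algebraMap A B) ≤ J) (n : ℕ) (hJI : J ^ n ≤ I.map (algebraMap A B)) :
    Module.Finite A B := by
  obtain ⟨E, hE⟩ := exists_finset_span_dense (A := A) J hfg hA n
  have : IsPrecomplete I (E → A) := isPrecomplete_pi I
  have : IsHausdorff (I.map (algebraMap A B)) B := IsHausdorff.of_ideal_le hIJ
  have : IsHausdorff I B := IsHausdorff.map_algebraMap_iff.1 this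
  let f : (E → A) →ₗ[A] B := Fintype.linearCombination A (fun x : E => (x : B))
  refine Module.Finite.of_surjective f (surjective_of_mkQ_comp_surjective (I := I) ?_)
  intro y
  obtain ⟨b, rfl⟩ := Submodule.mkQ_surjective _ y
  obtain ⟨b', hb', h⟩ := hE b
  have hr : b' ∈ LinearMap.range f := by
    rw [Fintype.range_linearCombination]
    simpa using hb'
  obtain ⟨v, rfl⟩ := hr
  refine ⟨v, ?_⟩
  rw [LinearMap.comp_apply, eq_comm, ← sub_eq_zero, ← map_sub, Submodule.mkQ_apply,
    Submodule.Quotient.mk_eq_zero, Ideal.smul_top_eq_map]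
  exact hJI h

section

open IsLocalRing

variable {R B : Type*} [CommRing R] [IsLocalRing R] [CommRing B] [Algebra R B]

theorem IsMaximalAdicCompletion.exists_mem_of_mem_map (h : IsMaximalAdicCompletion R B)
    (K : Ideal R) (n : ℕ) {b : B} (hb : b ∈ K.map (algebraMap R B)) :
    ∃ r ∈ K, b - algebraMap R B r ∈ (maximalIdeal R).map (algebraMap R B) ^ n := by
  induction hb using Submodule.span_induction with
  | mem x hx =>
    obtain ⟨r, hr, rfl⟩ := hx
    exact ⟨r, hr, by simp⟩
  | zero => exact ⟨0, zero_mem _, by simp⟩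
  | add x y _ _ hx hy =>
    obtain ⟨x', hx', hx⟩ := hx
    obtain ⟨y', hy', hy⟩ := hy
    exact ⟨x' + y', add_mem hx' hy', by rw [map_add, add_sub_add_comm]; exact add_mem hx hy⟩
  | smul b x _ hx =>
    obtain ⟨x', hx', hx⟩ := hx
    obtain ⟨a, ha⟩ := h.dense n b
    refine ⟨a * x', Ideal.mul_mem_left _ _ hx', ?_⟩
    rw [map_mul, smul_eq_mul, show b * x - algebraMap R B a * algebraMap R B x' =
      b * (x - algebraMap R B x') + algebraMap R B x' * (b - algebraMap R B a) by ring]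
    exact add_mem (Ideal.mul_mem_left _ _ hx) (Ideal.mul_mem_left _ _ ha)

theorem IsMaximalAdicCompletion.mem_sup_of_mem_map_sup (h : IsMaximalAdicCompletion R B)
    (K : Ideal R) (n : ℕ) {r : R} (hr : algebraMap R B r ∈
      K.map (algebraMap R B) ⊔ (maximalIdeal R).map (algebraMap R B) ^ n) :
    r ∈ K ⊔ maximalIdeal R ^ n := by
  obtain ⟨b, hb, c, hc, hbc⟩ := Submodule.mem_sup.1 hr
  obtain ⟨s, hs, hbs⟩ := h.exists_mem_of_mem_map K n hb
  rw [← sub_add_cancel r s, add_comm]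
  refine Submodule.add_mem_sup hs (h.mem_pow n _ ?_)
  rw [map_sub, ← hbc, show b + c - algebraMap R B s = (b - algebraMap R B s) + c by ring]
  exact add_mem hbs hc

theorem mem_of_forall_mem_sup_maximalIdeal_pow [IsNoetherianRing R] (K : Ideal R) {r : R}
    (hr : ∀ n, r ∈ K ⊔ maximalIdeal R ^ n) : r ∈ K := by
  have := IsHausdorff.of_isLocalRing (maximalIdeal R) (R ⧸ K) (Ideal.IsPrime.ne_top
    (inferInstance : (maximalIdeal R).IsPrime))
  rw [← Ideal.Quotient.eq_zero_iff_mem]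
  refine IsHausdorff.haus this _ fun n => ?_
  rw [SModEq.zero]
  obtain ⟨s, hs, t, ht, rfl⟩ := Submodule.mem_sup.1 (hr n)
  rw [map_add, Ideal.Quotient.eq_zero_iff_mem.2 hs, zero_add]
  have := Submodule.smul_mem_smul ht (Submodule.mem_top (R := R) (x := (1 : R ⧸ K)))
  rwa [Algebra.smul_def, mul_one] at this

/-- Ideals of a Noetherian local ring are contracted from its completion. -/
theorem IsMaximalAdicCompletion.mem_of_mem_map [IsNoetherianRing R]
    (h : IsMaximalAdicCompletion R B) (K : Ideal R) {r : R}
    (hr : algebraMap R B r ∈ K.map (algebraMap R B)) : r ∈ K :=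
  mem_of_forall_mem_sup_maximalIdeal_pow K fun n =>
    h.mem_sup_of_mem_map_sup K n (Ideal.mem_sup_left hr)

theorem exists_maximalIdeal_pow_le_of_mem_minimalPrimes [IsNoetherianRing R] {K : Ideal R}
    (h : maximalIdeal R ∈ K.minimalPrimes) : ∃ n, maximalIdeal R ^ n ≤ K := by
  refine Ideal.exists_pow_le_of_le_radical_of_fg ?_ (maximalIdeal R).fg_of_isNoetherianRing
  rw [Ideal.radical_eq_sInf]
  refine le_sInf fun P hP => ?_
  have := hP.2
  exact h.2 ⟨hP.2, hP.1⟩ (le_maximalIdeal hP.2.ne_top)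

theorem mem_minimalPrimes_of_maximalIdeal_pow_le {K : Ideal R} {n : ℕ} (hK : K ≤ maximalIdeal R)
    (h : maximalIdeal R ^ n ≤ K) : maximalIdeal R ∈ K.minimalPrimes :=
  ⟨⟨inferInstance, hK⟩, fun P hP _ => by
    have := hP.1
    exact Ideal.IsPrime.le_of_pow_le (h.trans hP.2)⟩

/-- A nonzero power series in `d` variables over a field, together with fewer than `d` further
elements, generates an ideal that contains a power of the maximal ideal. -/
theorem MvPowerSeries.exists_finset_card_lt {k : Type*} [Field k] {d : ℕ}
    {f : MvPowerSeries (Fin d) k} (hf : f ≠ 0) (hfm : f ∈ maximalIdeal (MvPowerSeries (Fin d) k)) :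
    ∃ (Y : Finset (MvPowerSeries (Fin d) k)) (n : ℕ), Y.card < d ∧
      (∀ y ∈ Y, y ∈ maximalIdeal (MvPowerSeries (Fin d) k)) ∧
      maximalIdeal (MvPowerSeries (Fin d) k) ^ n ≤ Ideal.span {f} ⊔ Ideal.span (Y : Set _) := by
  classical
  let A := MvPowerSeries (Fin d) k
  have hne : Ideal.span {f} ≠ ⊤ := fun h => by
    have : Ideal.span {f} ≤ maximalIdeal A := (Ideal.span_singleton_le_iff_mem _).2 hfm
    rw [h] at this
    exact Ideal.IsPrime.ne_top' (top_le_iff.1 this)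
  have : Nontrivial (A ⧸ Ideal.span {f}) := Ideal.Quotient.nontrivial_iff.2 hne
  have : IsLocalRing (A ⧸ Ideal.span {f}) :=
    IsLocalRing.of_surjective' (Ideal.Quotient.mk _) Ideal.Quotient.mk_surjective
  have h1 : ringKrullDim (A ⧸ Ideal.span {f}) + 1 ≤ d := by
    refine (ringKrullDim_quotient_succ_le_of_nonZeroDivisor
      (mem_nonZeroDivisors_of_ne_zero hf)).trans
        ((ringKrullDim_le_spanFinrank_maximalIdeal A).trans ?_)
    rw [MvPowerSeries.maximalIdeal_eq_span_X]
    have h2 := Submodule.spanFinrank_span_le_ncard_of_finite (R := A)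
      (Set.finite_range (MvPowerSeries.X : Fin d → A))
    have h3 : (Set.range (MvPowerSeries.X : Fin d → A)).ncard ≤ d := by
      rw [← Set.image_univ]
      refine (Set.ncard_image_le Set.finite_univ).trans ?_
      simp
    exact_mod_cast h2.trans h3
  obtain ⟨s, hs, hcard⟩ := Ideal.exists_finset_card_eq_height_of_isNoetherianRing
    (maximalIdeal (A ⧸ Ideal.span {f}))
  rw [← maximalIdeal_height_eq_ringKrullDim, ← hcard] at h1
  have hlt : s.card < d := by
    have h2 : ((s.card + 1 : ℕ) : WithBot ℕ∞) ≤ (d : ℕ) := by exact_mod_cast h1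
    exact_mod_cast h2
  obtain ⟨n, hn⟩ := exists_maximalIdeal_pow_le_of_mem_minimalPrimes hs
  let mk := Ideal.Quotient.mk (Ideal.span {f})
  let t : A ⧸ Ideal.span {f} → A := Function.surjInv Ideal.Quotient.mk_surjective
  have ht : ∀ y, mk (t y) = y := Function.surjInv_eq _
  have hloc : IsLocalHom mk := IsLocalHom.of_surjective mk Ideal.Quotient.mk_surjective
  have hmax : ∀ x, mk x ∈ maximalIdeal (A ⧸ Ideal.span {f}) ↔ x ∈ maximalIdeal A := by
    intro x
    rw [mem_maximalIdeal, mem_maximalIdeal, mem_nonunits_iff, mem_nonunits_iff]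
    exact (isUnit_map_iff mk x).not
  refine ⟨s.image t, n, Finset.card_image_le.trans_lt hlt, ?_, ?_⟩
  · intro y hy
    obtain ⟨z, hz, rfl⟩ := Finset.mem_image.1 hy
    rw [← hmax, ht]
    exact hs.1.2 (Ideal.subset_span hz)
  · intro x hx
    have h2 : mk x ∈ maximalIdeal (A ⧸ Ideal.span {f}) ^ n := by
      have := Ideal.mem_map_of_mem mk hx
      rw [Ideal.map_pow] at this
      refine Ideal.pow_right_mono ?_ n this
      rw [Ideal.map_le_iff_le_comap]
      exact fun z hz => (hmax z).2 hz
    have h3 : mk x ∈ (Ideal.span ((s.image t : Finset A) : Set A)).map mk := by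
      rw [Ideal.map_span, Finset.coe_image, Set.image_image]
      simpa [ht] using hn h2
    rw [Ideal.mem_map_iff_of_surjective _ Ideal.Quotient.mk_surjective] at h3
    obtain ⟨y, hy, hyx⟩ := h3
    rw [← sub_add_cancel x y]
    refine Submodule.add_mem_sup ?_ hy
    rw [← Ideal.Quotient.eq_zero_iff_mem, map_sub, sub_eq_zero]
    exact hyx.symm

/-- A system of parameters of `R` is analytically independent: a map to the completion from a power
series ring in `dim R` variables is injective if the variables generate an ideal primary to the
maximal ideal. Otherwise the completion, hence `R`, would have an ideal primary to the maximal
ideal with too few generators. -/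
theorem IsMaximalAdicCompletion.injective_of_ringKrullDim_eq [IsNoetherianRing R]
    (h : IsMaximalAdicCompletion R B) {k : Type*} [Field k] {d : ℕ} (hd : ringKrullDim R = d)
    (θ : MvPowerSeries (Fin d) k →+* B)
    (hθ : (maximalIdeal (MvPowerSeries (Fin d) k)).map θ ≤ (maximalIdeal R).map (algebraMap R B))
    (n : ℕ) (hn : (maximalIdeal R).map (algebraMap R B) ^ n ≤
      (maximalIdeal (MvPowerSeries (Fin d) k)).map θ) : Function.Injective θ := by
  classical
  have hB : Nontrivial B := by
    by_contra hB
    rw [not_nontrivial_iff_subsingleton] at hB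
    have h1 := h.mem_pow 1 1 (by rw [Subsingleton.elim (algebraMap R B 1) 0]; exact zero_mem _)
    rw [pow_one] at h1
    exact (Ideal.ne_top_iff_one _).1 (Ideal.IsPrime.ne_top') h1
  rw [injective_iff_map_eq_zero]
  intro f hf
  by_contra hf0
  have hfm : f ∈ maximalIdeal (MvPowerSeries (Fin d) k) := by
    rw [mem_maximalIdeal, mem_nonunits_iff]
    intro hu
    exact not_isUnit_zero (hf ▸ hu.map θ)
  obtain ⟨Y, N, hcard, hYm, hY⟩ := MvPowerSeries.exists_finset_card_lt hf0 hfm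
  set J := (maximalIdeal R).map (algebraMap R B) with hJ
  have hJY : J ^ (n * N) ≤ Ideal.span (θ '' (Y : Set _)) := by
    rw [pow_mul]
    refine (Ideal.pow_right_mono hn N).trans ?_
    rw [← Ideal.map_pow]
    refine (Ideal.map_mono hY).trans ?_
    rw [Ideal.map_sup, Ideal.map_span, Ideal.map_span, Set.image_singleton, hf]
    simp
  -- lift the few generators from `B` to `R`, modulo a high power of the maximal ideal; Nakayama's
  -- lemma shows that they still generate an ideal primary to the maximal ideal
  choose g hg using fun b => h.dense (n * N + 1) b
  let s : Finset R := Y.image fun y => g (θ y)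
  have hsm : Ideal.span (s : Set R) ≤ maximalIdeal R := by
    rw [Ideal.span_le]
    intro r hr
    obtain ⟨y, hy, rfl⟩ := Finset.mem_image.1 hr
    have := h.mem_pow 1 (g (θ y)) (by
      rw [pow_one, ← sub_sub_cancel (θ y) (algebraMap R B (g (θ y)))]
      refine sub_mem (hθ (Ideal.mem_map_of_mem _ (hYm y hy))) ?_
      exact Ideal.pow_le_self (Nat.succ_ne_zero _) (hg (θ y)))
    simpa using this
  have hle : maximalIdeal R ^ (n * N) ≤
      Ideal.span (s : Set R) ⊔ maximalIdeal R • maximalIdeal R ^ (n * N) := by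
    intro x hx
    rw [smul_eq_mul, ← pow_succ']
    refine h.mem_sup_of_mem_map_sup _ _ ?_
    have h1 : algebraMap R B x ∈ J ^ (n * N) := by
      rw [hJ, ← Ideal.map_pow]
      exact Ideal.mem_map_of_mem _ hx
    refine (Ideal.span_le.2 ?_) (hJY h1)
    rintro _ ⟨y, hy, rfl⟩
    have he : θ y = algebraMap R B (g (θ y)) + (θ y - algebraMap R B (g (θ y))) := by ring
    rw [SetLike.mem_coe, he]
    refine Submodule.add_mem_sup (Ideal.mem_map_of_mem _ (Ideal.subset_span ?_)) (hg _)
    exact Finset.mem_image_of_mem _ hy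
  have hle' := Submodule.le_of_le_smul_of_le_jacobson_bot
    ((maximalIdeal R ^ (n * N)).fg_of_isNoetherianRing)
    (IsLocalRing.maximalIdeal_le_jacobson ⊥) hle
  have hht := Ideal.height_le_card_of_mem_minimalPrimes_span_finset
    (mem_minimalPrimes_of_maximalIdeal_pow_le hsm hle')
  have h2 : (d : WithBot ℕ∞) ≤ (s.card : ℕ) := by
    rw [← hd, ← maximalIdeal_height_eq_ringKrullDim]
    exact_mod_cast hht
  have h3 : d ≤ s.card := by exact_mod_cast h2
  exact absurd (h3.trans Finset.card_image_le) (not_le.2 hcard)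

end

/-! ### Colon capturing -/

/-- A finite module over a domain becomes, after multiplication by some `c ≠ 0`, a submodule of a
finite free module: coordinates with respect to a maximal linearly independent set of generators. -/
theorem Module.Finite.exists_smul_eq_sum (A M : Type*) [CommRing A] [IsDomain A] [AddCommGroup M]
    [Module A M] [Module.Finite A M] :
    ∃ (c : A) (n : ℕ) (v : Fin n → M) (L : Fin n → M →ₗ[A] A), c ≠ 0 ∧
      ∀ b, c • b = ∑ l, L l b • v l := by
  classical
  obtain ⟨n, v, hv⟩ := Module.Finite.exists_fin (R := A) (M := M)
  obtain ⟨s, hs, hmax⟩ := exists_maximal_linearIndepOn A v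
  have h1 : ∀ i, ∃ a : A, a ≠ 0 ∧ a • v i ∈ Submodule.span A (v '' s) := by
    intro i
    by_cases hi : i ∈ s
    · exact ⟨1, one_ne_zero, by rw [one_smul]; exact Submodule.subset_span ⟨i, hi, rfl⟩⟩
    · exact hmax i hi
  choose a ha0 ha using h1
  have hc : ∀ b, (∏ i, a i) • b ∈ Submodule.span A (v '' s) := by
    intro b
    have hb : b ∈ Submodule.span A (Set.range v) := hv ▸ trivial
    induction hb using Submodule.span_induction with
    | mem x hx =>
      obtain ⟨i, rfl⟩ := hx
      rw [← Finset.prod_erase_mul _ _ (Finset.mem_univ i), mul_smul]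
      exact Submodule.smul_mem _ _ (ha i)
    | zero => rw [smul_zero]; exact zero_mem _
    | add x y _ _ hx hy => rw [smul_add]; exact add_mem hx hy
    | smul t x _ hx => rw [smul_comm]; exact Submodule.smul_mem _ _ hx
  rw [Set.image_eq_range] at hc
  let w : s → M := fun i => v i
  have hw : LinearIndependent A w := hs
  let mulc : M →ₗ[A] Submodule.span A (Set.range w) :=
    LinearMap.codRestrict _ ((∏ i, a i) • LinearMap.id) hc
  let L : Fin n → M →ₗ[A] A := fun l =>
    if hl : l ∈ s then (Finsupp.lapply (⟨l, hl⟩ : s)) ∘ₗ hw.repr ∘ₗ mulc else 0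
  refine ⟨∏ i, a i, n, v, L, Finset.prod_ne_zero_iff.2 fun i _ => ha0 i, fun b => ?_⟩
  have h2 := hw.linearCombination_repr (mulc b)
  rw [Finsupp.linearCombination_apply, Finsupp.sum_fintype _ _ (by simp)] at h2
  have h3 : ((mulc b : Submodule.span A (Set.range w)) : M) = (∏ i, a i) • b := rfl
  rw [← h3, ← h2]
  have h4 : ∀ l, L l b • v l = if hl : l ∈ s then (hw.repr (mulc b)) ⟨l, hl⟩ • w ⟨l, hl⟩ else 0 := by
    intro l
    by_cases hl : l ∈ s
    · simp only [L, hl, dif_pos]; rfl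
    · simp [L, hl]
  rw [Finset.sum_congr rfl fun l _ => h4 l]
  rw [← Finset.sum_subset (Finset.subset_univ (Finset.univ.filter (· ∈ s)))
    (fun x _ hx => dif_neg (by simpa using hx))]
  symm
  refine Finset.sum_bij' (fun l hl => (⟨l, by simpa using hl⟩ : s)) (fun i _ => i.1)
    (by simp) (by simp) (by simp) (by simp) ?_
  intro l hl
  rw [dif_pos]

theorem MvPowerSeries.isDomain_of_field (σ k : Type*) [Field k] :
    IsDomain (MvPowerSeries σ k) :=
  NoZeroDivisors.to_isDomain _

/-- **Colon capturing**: over a power series ring, a finite algebra satisfies the relations of a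
regular sequence in powers of the variables up to a fixed multiplier `c ≠ 0`. -/
theorem MvPowerSeries.exists_colon_capturing {k B : Type*} [Field k] [CommRing B] {d : ℕ}
    (θ : MvPowerSeries (Fin d) k →+* B) (hθ : θ.Finite) :
    ∃ c : MvPowerSeries (Fin d) k, c ≠ 0 ∧ ∀ (q : ℕ) (s : Finset (Fin d)) (i : Fin d), i ∉ s →
      ∀ r : B, θ (MvPowerSeries.X i) ^ q * r ∈
          Ideal.span ((fun j => θ (MvPowerSeries.X j) ^ q) '' (s : Set (Fin d))) →
        θ c * r ∈ Ideal.span ((fun j => θ (MvPowerSeries.X j) ^ q) '' (s : Set (Fin d))) := by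
  let := θ.toAlgebra
  have : Module.Finite (MvPowerSeries (Fin d) k) B := hθ
  have := MvPowerSeries.isDomain_of_field (Fin d) k
  obtain ⟨c, n, v, L, hc, hL⟩ := Module.Finite.exists_smul_eq_sum (MvPowerSeries (Fin d) k) B
  refine ⟨c, hc, fun q s i hi r hr => ?_⟩
  let I := Ideal.span ((fun j => (MvPowerSeries.X j : MvPowerSeries (Fin d) k) ^ q) ''
    (s : Set (Fin d)))
  have hI : Ideal.span ((fun j => θ (MvPowerSeries.X j) ^ q) '' (s : Set (Fin d))) = I.map θ := by
    rw [Ideal.map_span, Set.image_image]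
    simp only [map_pow]
  rw [hI] at hr ⊢
  have hLI : ∀ l, ∀ b ∈ I.map θ, L l b ∈ I := by
    intro l b hb
    have h1 : b ∈ (I • ⊤ : Submodule (MvPowerSeries (Fin d) k) B) := by
      rw [Ideal.smul_top_eq_map]
      exact hb
    have h2 := Submodule.mem_map_of_mem (f := L l) h1
    rw [Submodule.map_smul''] at h2
    have h3 := Submodule.smul_mono (le_refl I) (le_top (a := Submodule.map (L l) ⊤)) h2
    simpa using h3
  change c • r ∈ I.map θ
  rw [hL]
  refine sum_mem fun l _ => ?_
  have h4 : L l r ∈ I := by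
    refine MvPowerSeries.mem_span_X_pow_of_X_pow_mul_mem s q hi _ ?_
    have h5 := hLI l _ hr
    rwa [← map_pow, show θ (MvPowerSeries.X i ^ q) * r =
      (MvPowerSeries.X i ^ q : MvPowerSeries (Fin d) k) • r from rfl, map_smul, smul_eq_mul] at h5
  exact Ideal.mul_mem_right _ _ (Ideal.mem_map_of_mem θ h4)

theorem charP_of_ringHom (p : ℕ) [Fact p.Prime] {R B : Type*} [CommRing R] [CommRing B]
    [Nontrivial B] [CharP R p] (f : R →+* B) : CharP B p := by
  rw [CharP.charP_iff_prime_eq_zero Fact.out, ← map_natCast f, CharP.cast_eq_zero, map_zero]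

/-! ### Power series rings in the completion -/

section

open IsLocalRing

variable {R : Type*} {B : Type u} [CommRing R] [IsLocalRing R] [CommRing B] [Algebra R B]

theorem IsMaximalAdicCompletion.isMaximal_map (h : IsMaximalAdicCompletion R B) :
    ((maximalIdeal R).map (algebraMap R B)).IsMaximal := by
  rw [Ideal.isMaximal_iff]
  refine ⟨fun h1 => ?_, fun I x hI hx hxI => ?_⟩
  · have := h.mem_pow 1 1 (by rwa [pow_one, map_one])
    rw [pow_one] at this
    exact (Ideal.ne_top_iff_one _).1 Ideal.IsPrime.ne_top' this
  · obtain ⟨r, hr⟩ := h.dense 1 x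
    rw [pow_one] at hr
    have hru : IsUnit r := by
      by_contra hru
      have := Ideal.mem_map_of_mem (algebraMap R B) ((mem_maximalIdeal r).2 hru)
      exact hx (by simpa using add_mem hr this)
    have hrI : algebraMap R B r ∈ I := by simpa using sub_mem hxI (hI hr)
    rw [← Ideal.eq_top_iff_one]
    exact Ideal.eq_top_of_isUnit_mem _ hrI (hru.map _)

/-- **Noether normalization** for the completion of a Noetherian local ring of characteristic `p`:
elements `x` that generate an ideal primary to the maximal ideal define a finite map from a power
series ring over a coefficient field. -/
theorem IsMaximalAdicCompletion.exists_noether_normalization (p : ℕ) [Fact p.Prime]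
    [IsNoetherianRing R] [CharP R p] (h : IsMaximalAdicCompletion R B) {d : ℕ} (x : Fin d → R)
    (hx : ∀ i, x i ∈ maximalIdeal R) (n : ℕ)
    (hn : maximalIdeal R ^ n ≤ Ideal.span (Set.range x)) :
    ∃ (k : Type u) (_ : Field k) (_ : CharP k p) (θ : MvPowerSeries (Fin d) k →+* B),
      (∀ i, θ (MvPowerSeries.X i) = algebraMap R B (x i)) ∧ θ.Finite ∧
      (ringKrullDim R = d → Function.Injective θ) ∧
      (maximalIdeal R ≤ Ideal.span (Set.range x) → Function.Surjective θ) := by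
  set J := (maximalIdeal R).map (algebraMap R B) with hJ
  have hJm : J.IsMaximal := h.isMaximal_map
  have hB : Nontrivial B := by
    by_contra hB
    rw [not_nontrivial_iff_subsingleton] at hB
    exact hJm.ne_top ((Ideal.eq_top_iff_one J).2
      (by rw [Subsingleton.elim (1 : B) 0]; exact zero_mem _))
  have hBp : CharP B p := charP_of_ringHom p (algebraMap R B)
  have hBJ : IsAdicComplete J B := h.isAdicComplete
  have hfg : J.FG := ((maximalIdeal R).fg_of_isNoetherianRing).map _
  obtain ⟨s, hs⟩ := exists_coefficientField p J
  let : Field (B ⧸ J) := Ideal.Quotient.field J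
  have hk : CharP (B ⧸ J) p := charP_of_ringHom p (Ideal.Quotient.mk J)
  obtain ⟨θ, hθC, hθX⟩ := exists_mvPowerSeries_eval J s (fun i => algebraMap R B (x i))
    (fun i => Ideal.mem_map_of_mem _ (hx i))
  have hmap : (maximalIdeal (MvPowerSeries (Fin d) (B ⧸ J))).map θ =
      (Ideal.span (Set.range x)).map (algebraMap R B) := by
    rw [MvPowerSeries.maximalIdeal_eq_span_X, Ideal.map_span, Ideal.map_span, ← Set.range_comp,
      ← Set.range_comp]
    congr 2
    ext i
    exact hθX i
  have hle : (maximalIdeal (MvPowerSeries (Fin d) (B ⧸ J))).map θ ≤ J := by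
    rw [hmap]
    refine Ideal.map_mono (Ideal.span_le.2 ?_)
    rintro _ ⟨i, rfl⟩
    exact hx i
  have hle' : J ^ n ≤ (maximalIdeal (MvPowerSeries (Fin d) (B ⧸ J))).map θ := by
    rw [hmap, hJ, ← Ideal.map_pow]
    exact Ideal.map_mono hn
  have hres : ∀ b : B, ∃ a, b - θ a ∈ J := fun b =>
    ⟨MvPowerSeries.C (Ideal.Quotient.mk J b), by
      rw [hθC, ← Ideal.Quotient.eq_zero_iff_mem, map_sub, hs, sub_self]⟩
  have hA : IsAdicComplete (maximalIdeal (MvPowerSeries (Fin d) (B ⧸ J)))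
      (MvPowerSeries (Fin d) (B ⧸ J)) := by
    rw [MvPowerSeries.maximalIdeal_eq_span_X]
    infer_instance
  refine ⟨B ⧸ J, inferInstance, hk, θ, hθX, ?_, fun hd => ?_, fun hm => ?_⟩
  · let := θ.toAlgebra
    exact Module.finite_of_isAdicComplete (maximalIdeal (MvPowerSeries (Fin d) (B ⧸ J))) J hfg
      hres hle n hle'
  · exact h.injective_of_ringKrullDim_eq hd θ hle n hle'
  · have hmJ : (maximalIdeal (MvPowerSeries (Fin d) (B ⧸ J))).map θ = J := by
      refine le_antisymm hle ?_
      rw [hmap]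
      exact Ideal.map_mono hm
    have hH : IsHausdorff ((maximalIdeal (MvPowerSeries (Fin d) (B ⧸ J))).map θ) B := by
      rw [hmJ]
      infer_instance
    refine surjective_of_mk_map_comp_surjective
      (I := maximalIdeal (MvPowerSeries (Fin d) (B ⧸ J))) θ fun y => ?_
    obtain ⟨b, rfl⟩ := Ideal.Quotient.mk_surjective y
    obtain ⟨a, ha⟩ := hres b
    refine ⟨a, ?_⟩
    have ha' := hmJ.ge ha
    rw [RingHom.comp_apply, eq_comm, ← sub_eq_zero, ← map_sub]
    exact Ideal.Quotient.eq_zero_iff_mem.2 ha'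

end

/-! ### Splittings in completions of regular rings -/

/-- `C` is a domain of characteristic `p` in which every `c ≠ 0` is sent to `1` by some map that is
linear over the `e`-th Frobenius, for every sufficiently large `e`, and for every `e` if `c = 1`. -/
structure HasEventualFrobeniusSplittings (p : ℕ) (C : Type*) [CommRing C] : Prop where
  isDomain : IsDomain C
  exists_splitting : ∀ c : C, c ≠ 0 → ∃ e₀ : ℕ, ∀ e, e₀ ≤ e →
    ∃ Φ : C →+ C, (∀ g h, Φ (g ^ p ^ e * h) = g * Φ h) ∧ Φ c = 1
  exists_splitting_one : ∀ e : ℕ,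
    ∃ Φ : C →+ C, (∀ g h, Φ (g ^ p ^ e * h) = g * Φ h) ∧ Φ 1 = 1

theorem HasEventualFrobeniusSplittings.of_ringEquiv {p : ℕ} {C D : Type*} [CommRing C] [CommRing D]
    (f : C ≃+* D) (h : HasEventualFrobeniusSplittings p C) :
    HasEventualFrobeniusSplittings p D := by
  have key : ∀ (e : ℕ) (c : D),
      (∃ Φ : C →+ C, (∀ g h, Φ (g ^ p ^ e * h) = g * Φ h) ∧ Φ (f.symm c) = 1) →
      ∃ Φ : D →+ D, (∀ g h, Φ (g ^ p ^ e * h) = g * Φ h) ∧ Φ c = 1 := by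
    rintro e c ⟨Φ, h1, h2⟩
    refine ⟨f.toAddMonoidHom.comp (Φ.comp f.symm.toAddMonoidHom), fun g h => ?_, ?_⟩
    · change f (Φ (f.symm (g ^ p ^ e * h))) = g * f (Φ (f.symm h))
      rw [map_mul, map_pow, h1, map_mul, RingEquiv.apply_symm_apply]
    · change f (Φ (f.symm c)) = 1
      rw [h2, map_one]
  have := h.isDomain
  refine ⟨f.symm.toMulEquiv.isDomain, fun c hc => ?_, fun e => key e 1 ?_⟩
  · obtain ⟨e₀, he₀⟩ := h.exists_splitting (f.symm c) (by simpa using hc)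
    exact ⟨e₀, fun e he => key e c (he₀ e he)⟩
  · rw [map_one]
    exact h.exists_splitting_one e

theorem MvPowerSeries.hasEventualFrobeniusSplittings (p : ℕ) [Fact p.Prime] (K : Type*) [Field K]
    [CharP K p] (d : ℕ) : HasEventualFrobeniusSplittings p (MvPowerSeries (Fin d) K) := by
  refine ⟨MvPowerSeries.isDomain_of_field _ _, fun c hc => ?_, fun e => ?_⟩
  · obtain ⟨a, ha⟩ : ∃ a, MvPowerSeries.coeff a c ≠ 0 := by
      by_contra! h
      exact hc (MvPowerSeries.ext h)
    refine ⟨∑ i, a i, fun e he => MvPowerSeries.exists_frobenius_splitting p ha e fun i => ?_⟩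
    exact ((Finset.single_le_sum (fun j _ => Nat.zero_le (a j)) (Finset.mem_univ i)).trans
      he).trans_lt (Nat.lt_pow_self (Fact.out : p.Prime).one_lt)
  · refine MvPowerSeries.exists_frobenius_splitting p (a := 0) (by simp) e fun i => ?_
    exact pow_pos (Fact.out : p.Prime).pos e

open IsLocalRing in
/-- The completion of a regular local ring of characteristic `p` is a power series ring over a
field, so it inherits its Frobenius splittings. -/
theorem IsRegularLocalRing.hasEventualFrobeniusSplittings (p : ℕ) [Fact p.Prime] {T B : Type*}
    [CommRing T] [IsRegularLocalRing T] [CharP T p] [CommRing B] [Algebra T B]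
    (h : IsMaximalAdicCompletion T B) : HasEventualFrobeniusSplittings p B := by
  have hfg : (maximalIdeal T).FG := (maximalIdeal T).fg_of_isNoetherianRing
  let d := (maximalIdeal T).spanFinrank
  have hfin := Submodule.FG.finite_generators hfg
  have hcard : (maximalIdeal T).generators.ncard = d := Submodule.FG.generators_ncard hfg
  have : Finite (maximalIdeal T).generators := hfin
  let ε : Fin d ≃ (maximalIdeal T).generators :=
    (Finite.equivFinOfCardEq (by rw [← hcard]; rfl)).symm
  let x : Fin d → T := fun i => ε i
  have hspan : Ideal.span (Set.range x) = maximalIdeal T := by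
    have : Set.range x = (maximalIdeal T).generators := by
      rw [show x = Subtype.val ∘ ε from rfl, Set.range_comp, ε.range_eq_univ, Set.image_univ,
        Subtype.range_coe]
    rw [this]
    exact (maximalIdeal T).span_generators
  obtain ⟨k, _, _, θ, -, -, hinj, hsurj⟩ := h.exists_noether_normalization p x
    (fun i => by rw [← hspan]; exact Ideal.subset_span ⟨i, rfl⟩) 1 (by rw [pow_one, hspan])
  exact (MvPowerSeries.hasEventualFrobeniusSplittings p k d).of_ringEquiv
    (RingEquiv.ofBijective θ ⟨hinj (IsRegularLocalRing.spanFinrank_maximalIdeal).symm,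
      hsurj hspan.ge⟩)

/-! ### Cyclically pure ring maps -/

/-- A ring map is cyclically pure if every ideal of the source is contracted from the target. -/
def IsCyclicallyPure {R C : Type*} [CommRing R] [CommRing C] (f : R →+* C) : Prop :=
  ∀ (I : Ideal R) (r : R), f r ∈ I.map f → r ∈ I

theorem IsCyclicallyPure.comp {R S C : Type*} [CommRing R] [CommRing S] [CommRing C]
    {g : S →+* C} {f : R →+* S} (hg : IsCyclicallyPure g) (hf : IsCyclicallyPure f) :
    IsCyclicallyPure (g.comp f) := fun I r h =>
  hf I r (hg _ _ (by rwa [Ideal.map_map]))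

theorem IsCyclicallyPure.injective {R C : Type*} [CommRing R] [CommRing C] {f : R →+* C}
    (hf : IsCyclicallyPure f) : Function.Injective f := by
  rw [injective_iff_map_eq_zero]
  intro r hr
  exact hf ⊥ r (by rw [hr]; exact zero_mem _)

theorem isCyclicallyPure_of_split {R S : Type*} [CommRing R] [CommRing S] [Algebra R S]
    (φ : S →ₗ[R] R) (hφ : φ 1 = 1) : IsCyclicallyPure (algebraMap R S) := by
  intro I r hr
  have h1 : ∀ s ∈ I.map (algebraMap R S), φ s ∈ I := by
    intro s hs
    have h1 : s ∈ (I • ⊤ : Submodule R S) := by rwa [Ideal.smul_top_eq_map]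
    have h2 := Submodule.mem_map_of_mem (f := φ) h1
    rw [Submodule.map_smul''] at h2
    simpa using Submodule.smul_mono (le_refl I) (le_top (a := Submodule.map φ ⊤)) h2
  have := h1 _ hr
  rwa [Algebra.algebraMap_eq_smul_one, map_smul, hφ, smul_eq_mul, mul_one] at this

theorem IsCyclicallyPure.isNoetherianRing {R S : Type*} [CommRing R] [CommRing S]
    [IsNoetherianRing S] {f : R →+* S} (hf : IsCyclicallyPure f) : IsNoetherianRing R := by
  rw [isNoetherianRing_iff, isNoetherian_iff']
  have hmono : StrictMono (fun I : Ideal R => I.map f) := by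
    refine Monotone.strictMono_of_injective (fun I J h => Ideal.map_mono h) fun I J h => ?_
    refine le_antisymm (fun r hr => hf J r ?_) fun r hr => hf I r ?_
    · exact h ▸ Ideal.mem_map_of_mem f hr
    · exact h.symm ▸ Ideal.mem_map_of_mem f hr
  exact hmono.wellFoundedGT

/-- If `R → S` splits through `φ`, then over every prime `P` of `R` lies a prime `n` of `S` such
that `φ (s S)` is not contained in `P` for `s ∉ n`: the elements `s` with `φ (s S) ⊆ P` form an
ideal that contracts to `P`. -/
theorem exists_prime_of_split {R S : Type*} [CommRing R] [CommRing S] [Algebra R S]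
    (φ : S →ₗ[R] R) (hφ : φ 1 = 1) (P : Ideal R) [P.IsPrime] :
    ∃ n : Ideal S, n.IsPrime ∧ n.comap (algebraMap R S) = P ∧ ∀ s ∉ n, ∃ t, φ (s * t) ∉ P := by
  let a : Ideal S :=
    { carrier := {s | ∀ t, φ (s * t) ∈ P}
      zero_mem' := fun t => by simp
      add_mem' := fun {x y} hx hy t => by
        rw [add_mul, map_add]
        exact add_mem (hx t) (hy t)
      smul_mem' := fun b x hx t => by
        rw [smul_eq_mul, mul_comm b, mul_assoc]
        exact hx _ }
  have hdisj : Disjoint (a : Set S) (P.primeCompl.map (algebraMap R S)) := by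
    rw [Set.disjoint_left]
    rintro _ h1 ⟨r, hr, rfl⟩
    have := h1 1
    rw [mul_one] at this
    refine hr ?_
    change φ (algebraMap R S r) ∈ P at this
    rwa [Algebra.algebraMap_eq_smul_one, map_smul, hφ, smul_eq_mul, mul_one] at this
  obtain ⟨n, hn, han, hd⟩ := Ideal.exists_le_prime_disjoint a _ hdisj
  refine ⟨n, hn, le_antisymm (fun r hr => ?_) (fun r hr => han fun t => ?_), fun s hs => ?_⟩
  · by_contra hrP
    exact Set.disjoint_left.1 hd hr ⟨r, hrP, rfl⟩
  · rw [← Algebra.smul_def, map_smul]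
    exact P.mul_mem_right _ hr
  · by_contra! h
    exact hs (han h)

/-- A split map stays cyclically pure after localization at the primes of the preceding lemma. -/
theorem isCyclicallyPure_localRingHom_of_split {R S : Type*} [CommRing R] [CommRing S]
    [Algebra R S] (φ : S →ₗ[R] R) (P : Ideal R) [P.IsPrime] (n : Ideal S)
    [n.IsPrime] (hnP : P = n.comap (algebraMap R S)) (hn : ∀ s ∉ n, ∃ t, φ (s * t) ∉ P) :
    IsCyclicallyPure (Localization.localRingHom P n (algebraMap R S) hnP) := by
  intro I x hx
  obtain ⟨r, u, rfl⟩ := IsLocalization.exists_mk'_eq P.primeCompl x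
  let I₀ : Ideal R := I.comap (algebraMap R (Localization.AtPrime P))
  have hI : I = I₀.map (algebraMap R (Localization.AtPrime P)) :=
    (IsLocalization.map_under P.primeCompl (Localization.AtPrime P) I).symm
  have hcomp : (Localization.localRingHom P n (algebraMap R S) hnP).comp
      (algebraMap R (Localization.AtPrime P)) =
        (algebraMap S (Localization.AtPrime n)).comp (algebraMap R S) := by
    ext r
    simp [Localization.localRingHom_to_map]
  have h1 : algebraMap S (Localization.AtPrime n) (algebraMap R S r) ∈
      (I₀.map (algebraMap R S)).map (algebraMap S (Localization.AtPrime n)) := by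
    rw [Ideal.map_map, ← hcomp, ← Ideal.map_map, ← hI, ← RingHom.comp_apply, ← hcomp,
      RingHom.comp_apply, ← IsLocalization.mk'_spec (Localization.AtPrime P) r u, map_mul]
    exact Ideal.mul_mem_right _ _ hx
  rw [IsLocalization.algebraMap_mem_map_algebraMap_iff n.primeCompl] at h1
  obtain ⟨s, hs, hsr⟩ := h1
  obtain ⟨t, ht⟩ := hn s hs
  have h2 : φ (s * t) * r ∈ I₀ := by
    have h3 : (s * algebraMap R S r) * t ∈ I₀.map (algebraMap R S) := Ideal.mul_mem_right _ _ hsr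
    have h4 : (s * algebraMap R S r) * t ∈ (I₀ • ⊤ : Submodule R S) := by
      rwa [Ideal.smul_top_eq_map]
    have h5 := Submodule.mem_map_of_mem (f := φ) h4
    rw [Submodule.map_smul''] at h5
    have h6 := Submodule.smul_mono (le_refl I₀) (le_top (a := Submodule.map φ ⊤)) h5
    rw [show s * algebraMap R S r * t = r • (s * t) by rw [Algebra.smul_def]; ring, map_smul] at h6
    simpa [mul_comm] using h6
  rw [hI, IsLocalization.mk'_mem_map_algebraMap_iff P.primeCompl]
  exact ⟨_, ht, h2⟩

/-- A map `Φ` that is linear over `g ↦ g ^ q` sends the ideal generated by the `q`-th powers of the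
elements of `Y` into the ideal generated by `Y`. -/
theorem frobenius_splitting_mem_span {C : Type*} [CommRing C] {q : ℕ} (Φ : C →+ C)
    (hΦ : ∀ g h, Φ (g ^ q * h) = g * Φ h) (Y : Set C) {z : C}
    (hz : z ∈ Ideal.span ((fun y => y ^ q) '' Y)) : Φ z ∈ Ideal.span Y := by
  suffices ∀ b, Φ (b * z) ∈ Ideal.span Y by simpa using this 1
  induction hz using Submodule.span_induction with
  | mem x hx =>
    obtain ⟨y, hy, rfl⟩ := hx
    intro b
    rw [mul_comm]
    dsimp only
    rw [hΦ]
    exact Ideal.mul_mem_right _ _ (Ideal.subset_span hy)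
  | zero => simp
  | add x y _ _ hx hy => intro b; rw [mul_add, map_add]; exact add_mem (hx b) (hy b)
  | smul c x _ hx => intro b; rw [smul_eq_mul, ← mul_assoc]; exact hx _

/-! ### Normality and the Cohen-Macaulay property -/

/-- If `a / b` is integral, then `c a ^ n ∈ (b ^ n)` for some `c ≠ 0` and all `n`; a Frobenius
splitting along `c` yields `a ∈ (b)`. -/
theorem IsCyclicallyPure.isIntegrallyClosed {p : ℕ} {R C : Type*} [CommRing R]
    [CommRing C] {f : R →+* C} (hf : IsCyclicallyPure f)
    (hC : HasEventualFrobeniusSplittings p C) : IsDomain R ∧ IsIntegrallyClosed R := by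
  have := hC.isDomain
  have hR : IsDomain R := hf.injective.isDomain f
  refine ⟨hR, (isIntegrallyClosed_iff (FractionRing R)).2 fun {x} hx => ?_⟩
  obtain ⟨c, hc, hcx⟩ := hx.isAlmostIntegral
  obtain ⟨a, b, rfl⟩ := IsLocalization.exists_mk'_eq (nonZeroDivisors R) x
  have hfc : f c ≠ 0 := fun h => nonZeroDivisors.ne_zero hc (hf.injective (by rw [h, map_zero]))
  obtain ⟨e, he⟩ := hC.exists_splitting (f c) hfc
  obtain ⟨Φ, hΦ, hΦc⟩ := he e le_rfl
  obtain ⟨r, hr⟩ := hcx (p ^ e)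
  have h1 : c * a ^ p ^ e = r * b ^ p ^ e := by
    apply IsFractionRing.injective R (FractionRing R)
    rw [map_mul, map_mul, map_pow, map_pow]
    change algebraMap R (FractionRing R) r = _ at hr
    rw [hr, Algebra.smul_def, mul_assoc, ← mul_pow, IsLocalization.mk'_spec]
  have h2 : f a = f b * Φ (f r) := by
    rw [← hΦ, ← map_pow, ← map_mul, mul_comm, ← h1, mul_comm, map_mul, map_pow, hΦ, hΦc, mul_one]
  have h3 : a ∈ Ideal.span {(b : R)} := by
    refine hf _ _ ?_
    rw [h2]
    exact Ideal.mul_mem_right _ _ (Ideal.mem_map_of_mem _ (Ideal.mem_span_singleton_self _))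
  obtain ⟨y, hy⟩ := Ideal.mem_span_singleton.1 h3
  exact ⟨y, by rw [IsLocalization.eq_mk'_iff_mul_eq, hy, map_mul, mul_comm]⟩

section

open IsLocalRing

/-- A cyclically pure local map to a complete ring stays injective on the completion. -/
theorem IsCyclicallyPure.exists_adicCompletion_lift {R C : Type*} [CommRing R] [IsLocalRing R]
    [IsNoetherianRing R] [CommRing C] (J : Ideal C) [IsAdicComplete J C] {f : R →+* C}
    (hf : IsCyclicallyPure f) (hfJ : (maximalIdeal R).map f ≤ J) :
    ∃ g : AdicCompletion (maximalIdeal R) R →+* C, Function.Injective g ∧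
      ∀ r, g (algebraMap R _ r) = f r := by
  have hle : ∀ n, maximalIdeal R ^ n ≤ (J ^ n).comap f := fun n => by
    rw [← Ideal.map_le_iff_le_comap, Ideal.map_pow]
    exact Ideal.pow_right_mono hfJ n
  let F : (n : ℕ) → AdicCompletion (maximalIdeal R) R →+* C ⧸ J ^ n := fun n =>
    (Ideal.quotientMap (J ^ n) f (hle n)).comp
      (AdicCompletion.evalₐ (maximalIdeal R) n : _ →+* R ⧸ maximalIdeal R ^ n)
  have hF : ∀ {m n : ℕ} (h : m ≤ n), (Ideal.Quotient.factorPow J h).comp (F n) = F m := by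
    intro m n h
    ext z
    obtain ⟨x, rfl⟩ := AdicCompletion.mk_surjective _ _ z
    change Ideal.Quotient.factorPow J h (Ideal.quotientMap (J ^ n) f (hle n)
      (AdicCompletion.evalₐ (maximalIdeal R) n (AdicCompletion.mk (maximalIdeal R) R x))) =
        Ideal.quotientMap (J ^ m) f (hle m) (AdicCompletion.evalₐ (maximalIdeal R) m
          (AdicCompletion.mk (maximalIdeal R) R x))
    rw [AdicCompletion.evalₐ_mk, AdicCompletion.evalₐ_mk]
    change Ideal.Quotient.mk (J ^ m) (f (x.1 n)) = Ideal.Quotient.mk (J ^ m) (f (x.1 m))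
    rw [eq_comm, ← sub_eq_zero, ← map_sub, ← map_sub, Ideal.Quotient.eq_zero_iff_mem]
    refine hle m ?_
    have := SModEq.sub_mem.1 (x.2 h)
    simpa using this
  let g := IsAdicComplete.liftRingHom J F hF
  have hgr : ∀ r, g (algebraMap R _ r) = f r := by
    intro r
    rw [IsHausdorff.eq_iff_smodEq (I := J)]
    intro n
    rw [SModEq.sub_mem, smul_eq_mul, Ideal.mul_top, ← Ideal.Quotient.eq_zero_iff_mem, map_sub,
      IsAdicComplete.mk_liftRingHom]
    rw [sub_eq_zero]
    change Ideal.quotientMap (J ^ n) f (hle n) (AdicCompletion.evalₐ (maximalIdeal R) n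
      (algebraMap R _ r)) = _
    rw [AlgHom.commutes]
    rfl
  have hB := isMaximalAdicCompletion_adicCompletion R
  have hBc := hB.isAdicComplete
  have hgf : g.comp (algebraMap R _) = f := RingHom.ext hgr
  refine ⟨g, ?_, hgr⟩
  rw [injective_iff_map_eq_zero]
  intro z hz
  refine IsHausdorff.haus hBc.toIsHausdorff z fun n => ?_
  rw [SModEq.zero, smul_eq_mul, Ideal.mul_top]
  obtain ⟨r, hr⟩ := hB.dense n z
  have h1 : g (z - algebraMap R _ r) ∈ (maximalIdeal R ^ n).map f := by
    rw [← hgf, ← Ideal.map_map, Ideal.map_pow]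
    exact Ideal.mem_map_of_mem g hr
  rw [map_sub, hz, zero_sub, neg_mem_iff, hgr] at h1
  have h2 := Ideal.mem_map_of_mem (algebraMap R (AdicCompletion (maximalIdeal R) R)) (hf _ _ h1)
  rw [Ideal.map_pow] at h2
  simpa using add_mem hr h2

theorem pow_mem_span_pow (p : ℕ) [Fact p.Prime] {R : Type*} [CommRing R] [CharP R p] (e : ℕ)
    (Y : Set R) {z : R} (hz : z ∈ Ideal.span Y) :
    z ^ p ^ e ∈ Ideal.span ((fun y => y ^ p ^ e) '' Y) := by
  have := Ideal.mem_map_of_mem (iterateFrobenius R p e) hz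
  rwa [Ideal.map_span] at this

/-- The elements of a system of parameters form a regular sequence: a relation on them holds for
all `p ^ e`-th powers, colon capturing in the completion solves it up to a fixed multiplier, and a
Frobenius splitting along the multiplier removes it. -/
theorem IsCyclicallyPure.isCohenMacaulayLocalRing (p : ℕ) [Fact p.Prime] {R C : Type*} [CommRing R]
    [IsLocalRing R] [IsNoetherianRing R] [CharP R p] [CommRing C] (J : Ideal C)
    [IsAdicComplete J C] {f : R →+* C} (hf : IsCyclicallyPure f)
    (hfJ : (maximalIdeal R).map f ≤ J) (hC : HasEventualFrobeniusSplittings p C) :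
    IsCohenMacaulayLocalRing R := by
  classical
  have hCd := hC.isDomain
  obtain ⟨S, hS, hcard⟩ := Ideal.exists_finset_card_eq_height_of_isNoetherianRing (maximalIdeal R)
  obtain ⟨N, hN⟩ := exists_maximalIdeal_pow_le_of_mem_minimalPrimes hS
  let x : Fin S.card → R := fun i => S.equivFin.symm i
  have hxS : Set.range x = S := by
    rw [show x = Subtype.val ∘ S.equivFin.symm from rfl, Set.range_comp,
      S.equivFin.symm.range_eq_univ, Set.image_univ, Subtype.range_coe]
  have hdim : ringKrullDim R = S.card := by
    rw [← maximalIdeal_height_eq_ringKrullDim, ← hcard]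
    rfl
  have hxm : ∀ i, x i ∈ maximalIdeal R := fun i =>
    hS.1.2 (Ideal.subset_span (by rw [← hxS]; exact ⟨i, rfl⟩))
  obtain ⟨k, _, _, θ, hθX, hθ, hinj, -⟩ :=
    (isMaximalAdicCompletion_adicCompletion R).exists_noether_normalization p x hxm N
      (by rwa [hxS])
  obtain ⟨c, hc, hcap⟩ := MvPowerSeries.exists_colon_capturing θ hθ
  obtain ⟨g, hg, hgr⟩ := hf.exists_adicCompletion_lift J hfJ
  have hgc : g (θ c) ≠ 0 := fun h => hc (hinj hdim (hg (by rw [h, map_zero, map_zero])))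
  obtain ⟨e, he⟩ := hC.exists_splitting _ hgc
  obtain ⟨Φ, hΦ, hΦc⟩ := he e le_rfl
  have key : ∀ (s : Finset (Fin S.card)) (i : Fin S.card), i ∉ s → ∀ r,
      x i * r ∈ Ideal.span (x '' (s : Set _)) → r ∈ Ideal.span (x '' (s : Set _)) := by
    intro s i hi r hr
    have h1 := Ideal.mem_map_of_mem (algebraMap R (AdicCompletion (maximalIdeal R) R))
      (pow_mem_span_pow p e _ hr)
    rw [Ideal.map_span, Set.image_image, Set.image_image, mul_pow, map_mul, map_pow, ← hθX] at h1
    have h2 := hcap (p ^ e) s i hi (algebraMap R _ (r ^ p ^ e)) (by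
      simpa only [hθX, map_pow] using h1)
    have h3 := Ideal.mem_map_of_mem g h2
    rw [Ideal.map_span, Set.image_image, map_mul, hgr] at h3
    have h4 : (fun j => g (θ (MvPowerSeries.X j) ^ p ^ e)) '' (s : Set (Fin S.card)) =
        (fun y => y ^ p ^ e) '' (f '' (x '' (s : Set _))) := by
      rw [Set.image_image, Set.image_image]
      simp only [map_pow, hθX, hgr]
    rw [h4] at h3
    have h5 := frobenius_splitting_mem_span Φ hΦ _ h3
    rw [mul_comm, map_pow, hΦ, hΦc, mul_one, ← Ideal.map_span] at h5
    exact hf _ _ h5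
  refine ⟨inferInstance, inferInstance, List.ofFn x, ?_, ?_⟩
  · refine RingTheory.Sequence.IsRegular.of_isWeaklyRegular_of_mem_maximalIdeal R
      (fun r hr => ?_) ⟨fun i hi => ?_⟩
    · obtain ⟨i, rfl⟩ := (List.mem_ofFn' _ _).1 hr
      exact hxm i
    · have hi' : i < S.card := by simpa using hi
      have hlist : Ideal.ofList ((List.ofFn x).take i) =
          Ideal.span (x '' ((Finset.univ.filter fun j => j.1 < i : Finset (Fin S.card)) : Set _)) := by
        refine congrArg Ideal.span (Set.ext fun r => ?_)
        simp only [Set.mem_ofPred_eq, List.mem_take_iff_getElem, List.getElem_ofFn,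
          List.length_ofFn, Set.mem_image, Finset.coe_filter, Finset.mem_univ, true_and]
        constructor
        · rintro ⟨j, hj, rfl⟩
          exact ⟨⟨j, by omega⟩, by simp; omega, rfl⟩
        · rintro ⟨j, hj, rfl⟩
          exact ⟨j.1, by omega, rfl⟩
      rw [isSMulRegular_iff_right_eq_zero_of_smul]
      intro m hm
      obtain ⟨r, rfl⟩ := Submodule.mkQ_surjective _ m
      rw [← map_smul, Submodule.mkQ_apply, Submodule.Quotient.mk_eq_zero, smul_eq_mul, smul_eq_mul,
        Ideal.mul_top, hlist, List.getElem_ofFn] at hm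
      rw [Submodule.mkQ_apply, Submodule.Quotient.mk_eq_zero, smul_eq_mul, Ideal.mul_top, hlist]
      exact key _ ⟨i, hi'⟩ (by simp) r hm
  · rw [List.length_ofFn, hdim]

end

/-! ### Descent of Frobenius splittings -/

section

open IsLocalRing

theorem mem_smul_top_pi_iff {A ι : Type*} [CommRing A] [Finite ι] (I : Ideal A) (v : ι → A) :
    v ∈ (I • ⊤ : Submodule A (ι → A)) ↔ ∀ i, v i ∈ I := by
  classical
  have := Fintype.ofFinite ι
  constructor
  · intro h i
    have h1 := Submodule.mem_map_of_mem (f := (LinearMap.proj i : (ι → A) →ₗ[A] A)) h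
    rw [Submodule.map_smul''] at h1
    simpa using Submodule.smul_mono (le_refl I)
      (le_top (a := Submodule.map (LinearMap.proj i : (ι → A) →ₗ[A] A) ⊤)) h1
  · intro h
    rw [show v = ∑ i, v i • (Pi.single i (1 : A) : ι → A) by
      ext j; simp [Finset.sum_apply, Pi.single_apply]]
    exact Submodule.sum_mem _ fun i _ => Submodule.smul_mem_smul (h i) trivial

/-- Linear maps from a finite module to the completion of `T` can be approximated by linear maps to
`T`: they are the solutions of finitely many linear equations over `T`, so the Artin-Rees lemma
applies. -/
theorem IsMaximalAdicCompletion.exists_linearMap_approx {S T C M : Type*} [CommRing S]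
    [IsNoetherianRing S] [CommRing T] [IsLocalRing T] [IsNoetherianRing T] [Algebra S T]
    [CommRing C] [Algebra T C] (h : IsMaximalAdicCompletion T C) [AddCommGroup M] [Module S M]
    [Module.Finite S M] (φ : M →+ C)
    (hφ : ∀ s m, φ (s • m) = algebraMap T C (algebraMap S T s) * φ m) :
    ∃ ψ : M →ₗ[S] T, ∀ m, algebraMap T C (ψ m) - φ m ∈
      (maximalIdeal T).map (algebraMap T C) := by
  classical
  obtain ⟨N, π, hπ⟩ := Module.Finite.exists_fin' S M
  obtain ⟨u, κ, hκ⟩ := Submodule.fg_iff_exists_fin_generating_family.1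
    (IsNoetherian.noetherian (LinearMap.ker π))
  set J := (maximalIdeal T).map (algebraMap T C) with hJ
  let a : Fin N → C := fun i => φ (π (Pi.single i 1))
  have hsum : ∀ v : Fin N → S, φ (π v) = ∑ i, algebraMap T C (algebraMap S T (v i)) * a i := by
    intro v
    have hv : v = ∑ i, v i • (Pi.single i (1 : S) : Fin N → S) := by
      ext j; simp [Finset.sum_apply, Pi.single_apply]
    conv_lhs => rw [hv, map_sum, map_sum]
    refine Finset.sum_congr rfl fun i _ => ?_
    rw [map_smul, hφ]
  let β : (Fin N → T) →ₗ[T] (Fin u → T) :=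
    LinearMap.pi fun j => ∑ i, (algebraMap S T (κ j i)) • LinearMap.proj i
  have hβ : ∀ v j, β v j = ∑ i, algebraMap S T (κ j i) * v i := by
    intro v j
    simp [β, LinearMap.sum_apply, Algebra.smul_def]
  obtain ⟨K, hK⟩ := Ideal.exists_pow_inf_eq_pow_smul (maximalIdeal T) (LinearMap.range β)
  -- `b` solves the equations `β v = 0` modulo a high power of the maximal ideal; Artin-Rees gives a
  -- small correction `b'` such that `b - b'` solves them exactly
  choose b hb using fun i => h.dense (K + 1) (a i)
  have hβb : β b ∈ (maximalIdeal T ^ (K + 1) • ⊤ : Submodule T (Fin u → T)) := by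
    rw [mem_smul_top_pi_iff]
    intro j
    refine h.mem_pow _ _ ?_
    have h0 : (∑ i, algebraMap T C (algebraMap S T (κ j i)) * a i) = 0 := by
      rw [← hsum, show π (κ j) = 0 from by
        have : κ j ∈ LinearMap.ker π := hκ ▸ Submodule.subset_span ⟨j, rfl⟩
        exact this, map_zero]
    rw [hβ, map_sum, ← sub_zero (∑ i, _), ← h0, ← Finset.sum_sub_distrib]
    refine sum_mem fun i _ => ?_
    rw [map_mul, ← mul_sub, ← neg_sub, mul_neg, neg_mem_iff]
    exact Ideal.mul_mem_left _ _ (hb i)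
  have h1 : β b ∈ Submodule.map β (maximalIdeal T • ⊤) := by
    have h2 := (hK (K + 1) (Nat.le_succ K)).le ⟨hβb, ⟨b, rfl⟩⟩
    rw [Nat.add_sub_cancel_left, pow_one] at h2
    rw [Submodule.map_smul'', Submodule.map_top]
    exact Submodule.smul_mono le_rfl inf_le_right h2
  obtain ⟨b', hb', hbb⟩ := h1
  rw [SetLike.mem_coe, mem_smul_top_pi_iff] at hb'
  let g : (Fin N → S) →ₗ[S] T := Fintype.linearCombination S fun i => b i - b' i
  have hg : ∀ v, g v = ∑ i, algebraMap S T (v i) * (b i - b' i) := by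
    intro v
    simp only [g, Fintype.linearCombination_apply, Algebra.smul_def]
  have hker : LinearMap.ker π ≤ LinearMap.ker g := by
    rw [← hκ, Submodule.span_le]
    rintro _ ⟨j, rfl⟩
    change g (κ j) = 0
    simp only [hg, mul_sub, Finset.sum_sub_distrib, ← hβ, hbb, sub_self]
  refine ⟨(LinearMap.ker π).liftQ g hker ∘ₗ (π.quotKerEquivOfSurjective hπ).symm.toLinearMap, ?_⟩
  intro m
  obtain ⟨v, rfl⟩ := hπ m
  have h3 : (π.quotKerEquivOfSurjective hπ).symm (π v) = Submodule.Quotient.mk v := by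
    rw [LinearEquiv.symm_apply_eq]
    rfl
  rw [LinearMap.comp_apply, LinearEquiv.coe_coe, h3, Submodule.liftQ_apply, hsum, hg, map_sum,
    ← Finset.sum_sub_distrib]
  refine sum_mem fun i _ => ?_
  rw [map_mul, ← mul_sub, map_sub]
  refine Ideal.mul_mem_left _ _ ?_
  rw [show algebraMap T C (b i) - algebraMap T C (b' i) - a i =
    -(a i - algebraMap T C (b i)) - algebraMap T C (b' i) by ring]
  refine sub_mem (neg_mem (Ideal.pow_le_self (Nat.succ_ne_zero K) (hb i))) ?_
  exact Ideal.mem_map_of_mem _ (hb' i)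

/-- Descent of a splitting along a finite ring map from the completion of `S` at a prime `n` to
`S`. -/
theorem exists_splitting_notMem_of_completion {S S' C : Type*} [CommRing S] [IsNoetherianRing S]
    [CommRing S'] (F : S →+* S') (hF : F.Finite) (n : Ideal S) [n.IsPrime] [CommRing C]
    [Algebra (Localization.AtPrime n) C]
    (h : IsMaximalAdicCompletion (Localization.AtPrime n) C) (φ : S' →+ C)
    (hφ : ∀ s x, φ (F s * x) = algebraMap (Localization.AtPrime n) C (algebraMap S _ s) * φ x) :
    ∃ ψ : S' →+ S, (∀ s x, ψ (F s * x) = s * ψ x) ∧ ∀ x, φ x = 1 → ψ x ∉ n := by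
  let := F.toAlgebra
  have : Module.Finite S S' := hF
  have : Module.FinitePresentation S S' := Module.finitePresentation_of_finite S S'
  obtain ⟨ψ, hψ⟩ := h.exists_linearMap_approx (S := S) (M := S') φ hφ
  -- clear the denominator of `ψ`
  obtain ⟨ψ', u, hu⟩ := Module.FinitePresentation.exists_lift_of_isLocalizedModule n.primeCompl
    (Algebra.linearMap S (Localization.AtPrime n)) ψ
  refine ⟨ψ'.toAddMonoidHom, fun s x => ψ'.map_smul s x, fun x hx hxn => ?_⟩
  have h1 : algebraMap S (Localization.AtPrime n) (ψ' x) =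
      algebraMap S (Localization.AtPrime n) u * ψ x := by
    have := LinearMap.congr_fun hu x
    rw [LinearMap.smul_apply, Submonoid.smul_def, Algebra.smul_def] at this
    exact this
  have h2 : ψ x ∈ maximalIdeal (Localization.AtPrime n) := by
    have h3 : algebraMap S (Localization.AtPrime n) (ψ' x) ∈
        maximalIdeal (Localization.AtPrime n) :=
      (IsLocalization.AtPrime.to_map_mem_maximal_iff (Localization.AtPrime n) n _).2 hxn
    rw [h1] at h3
    refine ((Ideal.IsPrime.mem_or_mem inferInstance) h3).resolve_left fun h4 => u.2 ?_
    exact (IsLocalization.AtPrime.to_map_mem_maximal_iff (Localization.AtPrime n) n _).1 h4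
  have h3 := sub_mem (Ideal.mem_map_of_mem (algebraMap _ C) h2) (hψ x)
  rw [sub_sub_cancel, hx] at h3
  exact h.isMaximal_map.ne_top ((Ideal.eq_top_iff_one _).2 h3)

end

theorem IsFFinite.iterateFrobenius {p : ℕ} {R : Type*} [CommRing R] [ExpChar R p]
    (h : IsFFinite p R) (e : ℕ) : (iterateFrobenius R p e).Finite := by
  induction e with
  | zero => rw [iterateFrobenius_zero]; exact RingHom.Finite.id R
  | succ e ih =>
    rw [show _root_.iterateFrobenius R p (e + 1) =
      (frobenius R p).comp (_root_.iterateFrobenius R p e) from RingHom.ext fun x => by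
        simp [iterateFrobenius_def, frobenius_def, pow_succ, pow_mul]]
    exact RingHom.Finite.comp h ih

/-- The ideal of all values `φ (F^e_* f)` for `φ` in `Hom_R(F^e_* R, R)`. -/
def frobeniusTraceIdeal (p e : ℕ) {R : Type*} [CommRing R] (f : R) : Ideal R where
  carrier := {y | ∃ φ : R →+ R, (∀ r x, φ (r ^ p ^ e * x) = r * φ x) ∧ φ f = y}
  zero_mem' := ⟨0, by simp, rfl⟩
  add_mem' := by
    rintro _ _ ⟨φ, hφ, rfl⟩ ⟨ψ, hψ, rfl⟩
    exact ⟨φ + ψ, fun r x => by simp only [AddMonoidHom.add_apply, hφ, hψ, mul_add], rfl⟩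
  smul_mem' := by
    rintro c _ ⟨φ, hφ, rfl⟩
    exact ⟨(AddMonoidHom.mulLeft c).comp φ, fun r x => by
      simp only [AddMonoidHom.comp_apply, AddMonoidHom.coe_mulLeft, hφ]; ring, rfl⟩

/-- In an F-split ring the ideals of values increase with `e`: if `χ` splits Frobenius and `φ`
takes the value `y`, then `x ↦ χ (y ^ (p - 1) φ x)` takes the value `χ (y ^ p) = y`. -/
theorem frobeniusTraceIdeal_le_succ {p : ℕ} (hp : 0 < p) {R : Type*} [CommRing R]
    (h1 : (1 : R) ∈ frobeniusTraceIdeal p 1 (1 : R)) (e : ℕ) (f : R) :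
    frobeniusTraceIdeal p e f ≤ frobeniusTraceIdeal p (e + 1) f := by
  rintro _ ⟨φ, hφ, rfl⟩
  obtain ⟨χ, hχ, hχ1⟩ := h1
  refine ⟨χ.comp ((AddMonoidHom.mulLeft (φ f ^ (p - 1))).comp φ), fun r x => ?_, ?_⟩
  · simp only [AddMonoidHom.comp_apply, AddMonoidHom.coe_mulLeft]
    rw [pow_succ', pow_mul, hφ, mul_left_comm, ← hχ, pow_one]
  · simp only [AddMonoidHom.comp_apply, AddMonoidHom.coe_mulLeft]
    have := hχ (φ f) 1
    rw [pow_one, mul_one, hχ1, mul_one] at this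
    rwa [← pow_succ, Nat.sub_add_cancel hp]

/-- An element outside the minimal primes stays nonzero in every localization that is a domain. -/
theorem algebraMap_localization_ne_zero {R : Type*} [CommRing R] (P : Ideal R) [P.IsPrime]
    [IsDomain (Localization.AtPrime P)] {f : R} (hf : ∀ Q ∈ minimalPrimes R, f ∉ Q) :
    algebraMap R (Localization.AtPrime P) f ≠ 0 := by
  intro h
  have hQ : (RingHom.ker (algebraMap R (Localization.AtPrime P))).IsPrime := RingHom.ker_isPrime _
  refine hf _ ⟨⟨hQ, bot_le⟩, fun Q' hQ' hle z hz => ?_⟩ h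
  obtain ⟨u, hu⟩ := (IsLocalization.map_eq_zero_iff P.primeCompl (Localization.AtPrime P) z).1 hz
  refine (hQ'.1.mem_or_mem (x := (u : R)) (y := z) (hu ▸ Q'.zero_mem)).resolve_left fun h1 => ?_
  have h2 := hle h1
  have h3 := IsLocalization.map_units (Localization.AtPrime P) u
  rw [RingHom.mem_ker] at h2
  rw [h2] at h3
  exact not_isUnit_zero h3

/-! ### Direct summands of regular rings -/

open IsLocalRing in
/-- The local structure of a direct summand `R` of a regular ring `S`: over every prime `P` of `R`
there is a prime `n` of `S` such that the completion of `S_n` is a cyclically pure extension of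
`R_P` with Frobenius splittings. -/
theorem exists_cyclicallyPure_completion_of_split (p : ℕ) [Fact p.Prime] {R S : Type*} [CommRing R]
    [CommRing S] [CharP S p] [Algebra R S] [IsRegularRing S] (φ : S →ₗ[R] R)
    (hφ : φ 1 = 1) (P : Ideal R) [P.IsPrime] :
    ∃ (n : Ideal S) (_ : n.IsPrime) (f : Localization.AtPrime P →+*
        AdicCompletion (maximalIdeal (Localization.AtPrime n)) (Localization.AtPrime n)),
      (∀ s ∉ n, ∃ t, φ (s * t) ∉ P) ∧ IsCyclicallyPure f ∧
      (maximalIdeal (Localization.AtPrime P)).map f ≤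
        (maximalIdeal (Localization.AtPrime n)).map (algebraMap (Localization.AtPrime n)
          (AdicCompletion (maximalIdeal (Localization.AtPrime n)) (Localization.AtPrime n))) ∧
      (∀ r, f (algebraMap R _ r) =
        algebraMap (Localization.AtPrime n)
          (AdicCompletion (maximalIdeal (Localization.AtPrime n)) (Localization.AtPrime n))
          (algebraMap S (Localization.AtPrime n) (algebraMap R S r))) ∧
      HasEventualFrobeniusSplittings p
        (AdicCompletion (maximalIdeal (Localization.AtPrime n)) (Localization.AtPrime n)) := by
  obtain ⟨n, hn, hnP, hns⟩ := exists_prime_of_split φ hφ P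
  have : CharP (Localization.AtPrime n) p :=
    charP_of_ringHom p (algebraMap S (Localization.AtPrime n))
  have hT : IsRegularLocalRing (Localization.AtPrime n) :=
    IsRegularRing.isRegularLocalRing_localization n
  have hcomp := isMaximalAdicCompletion_adicCompletion (Localization.AtPrime n)
  refine ⟨n, hn, (algebraMap (Localization.AtPrime n)
    (AdicCompletion (maximalIdeal (Localization.AtPrime n)) (Localization.AtPrime n))).comp
    (Localization.localRingHom P n (algebraMap R S) hnP.symm), hns, ?_, ?_, fun r => ?_, ?_⟩
  · refine IsCyclicallyPure.comp (fun K r hr => hcomp.mem_of_mem_map K hr)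
      (isCyclicallyPure_localRingHom_of_split φ P n hnP.symm hns)
  · rw [← Ideal.map_map]
    refine Ideal.map_mono ?_
    exact ((IsLocalRing.local_hom_TFAE (Localization.localRingHom P n (algebraMap R S)
      hnP.symm)).out 0 2).1 (Localization.isLocalHom_localRingHom P n _ hnP.symm)
  · rw [RingHom.comp_apply, Localization.localRingHom_to_map]
  · exact IsRegularLocalRing.hasEventualFrobeniusSplittings p hcomp

theorem isCohenMacaulayRing_of_split (p : ℕ) [Fact p.Prime] {R S : Type*} [CommRing R]
    [CommRing S] [CharP R p] [CharP S p] [Algebra R S] [IsRegularRing S] (φ : S →ₗ[R] R)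
    (hφ : φ 1 = 1) : IsCohenMacaulayRing R := by
  have hR : IsNoetherianRing R := (isCyclicallyPure_of_split φ hφ).isNoetherianRing
  refine ⟨hR, fun P _ => ?_⟩
  obtain ⟨n, hn, f, -, hf, hfJ, -, hC⟩ := exists_cyclicallyPure_completion_of_split p φ hφ P
  have : CharP (Localization.AtPrime P) p :=
    charP_of_ringHom p (algebraMap R (Localization.AtPrime P))
  have := (isMaximalAdicCompletion_adicCompletion (Localization.AtPrime n)).isAdicComplete
  exact hf.isCohenMacaulayLocalRing p _ hfJ hC

theorem isNormalRing_of_split (p : ℕ) [Fact p.Prime] {R S : Type*} [CommRing R]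
    [CommRing S] [CharP S p] [Algebra R S] [IsRegularRing S] (φ : S →ₗ[R] R)
    (hφ : φ 1 = 1) : IsNormalRing R := by
  intro P _
  obtain ⟨n, hn, f, -, hf, -, -, hC⟩ := exists_cyclicallyPure_completion_of_split p φ hφ P
  exact hf.isIntegrallyClosed hC

/-- A Frobenius splitting over the completion of `S_n` descends to `S`, and the splitting of
`R → S` carries it to `R`. -/
theorem exists_notMem_frobeniusTraceIdeal (p : ℕ) [Fact p.Prime] {R S C : Type*} [CommRing R]
    [CommRing S] [CharP S p] [Algebra R S] [IsNoetherianRing S] (hS : IsFFinite p S)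
    (φ : S →ₗ[R] R) (P : Ideal R) (n : Ideal S) [n.IsPrime] (hn : ∀ s ∉ n, ∃ t, φ (s * t) ∉ P)
    [CommRing C] [Algebra (Localization.AtPrime n) C]
    (h : IsMaximalAdicCompletion (Localization.AtPrime n) C) (e : ℕ) (f : R) (Φ : C →+ C)
    (hΦ : ∀ g h, Φ (g ^ p ^ e * h) = g * Φ h)
    (hΦf : Φ (algebraMap (Localization.AtPrime n) C (algebraMap S _ (algebraMap R S f))) = 1) :
    ∃ y ∈ frobeniusTraceIdeal p e f, y ∉ P := by
  obtain ⟨ψ, hψ, hψn⟩ := exists_splitting_notMem_of_completion (iterateFrobenius S p e)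
    (hS.iterateFrobenius e) n h
    (Φ.comp ((algebraMap (Localization.AtPrime n) C).comp
      (algebraMap S (Localization.AtPrime n))).toAddMonoidHom) (fun s x => by
        simp only [AddMonoidHom.comp_apply, RingHom.toAddMonoidHom_eq_coe, AddMonoidHom.coe_coe,
          RingHom.comp_apply, map_mul, iterateFrobenius_def, map_pow, hΦ])
  obtain ⟨t, ht⟩ := hn _ (hψn (algebraMap R S f) hΦf)
  refine ⟨_, ⟨φ.toAddMonoidHom.comp ((AddMonoidHom.mulRight t).comp
    (ψ.comp (algebraMap R S).toAddMonoidHom)), fun r x => ?_, rfl⟩, ht⟩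
  change φ (ψ (algebraMap R S (r ^ p ^ e * x)) * t) = r * φ (ψ (algebraMap R S x) * t)
  rw [map_mul (algebraMap R S), map_pow (algebraMap R S), ← iterateFrobenius_def, hψ, mul_assoc,
    ← Algebra.smul_def, map_smul, smul_eq_mul]

theorem hasFrobeniusSplittings_of_split (p : ℕ) [Fact p.Prime] {R S : Type*} [CommRing R]
    [CommRing S] [CharP S p] [Algebra R S] [IsRegularRing S] (hS : IsFFinite p S)
    (φ : S →ₗ[R] R) (hφ : φ 1 = 1) : HasFrobeniusSplittings p R := by
  have hp : p.Prime := Fact.out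
  have h1 : (1 : R) ∈ frobeniusTraceIdeal p 1 (1 : R) := by
    rw [← Ideal.eq_top_iff_one]
    by_contra hne
    obtain ⟨P, hP, hle⟩ := Ideal.exists_le_maximal _ hne
    have := hP.isPrime
    obtain ⟨n, hn, g, hns, hg, -, hgr, hC⟩ := exists_cyclicallyPure_completion_of_split p φ hφ P
    obtain ⟨Φ, hΦ, hΦ1⟩ := hC.exists_splitting_one 1
    obtain ⟨y, hy, hyP⟩ := exists_notMem_frobeniusTraceIdeal p hS φ P n hns
      (isMaximalAdicCompletion_adicCompletion _) 1 1 Φ hΦ (by simpa using hΦ1)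
    exact hyP (hle hy)
  intro f hf
  have hmono : Monotone fun e => frobeniusTraceIdeal p (e + 1) f :=
    monotone_nat_of_le_succ fun e => frobeniusTraceIdeal_le_succ hp.pos h1 (e + 1) f
  have h2 : (1 : R) ∈ ⨆ e, frobeniusTraceIdeal p (e + 1) f := by
    rw [← Ideal.eq_top_iff_one]
    by_contra hne
    obtain ⟨P, hP, hle⟩ := Ideal.exists_le_maximal _ hne
    have := hP.isPrime
    obtain ⟨n, hn, g, hns, hg, -, hgr, hC⟩ := exists_cyclicallyPure_completion_of_split p φ hφ P
    have := (hg.isIntegrallyClosed hC).1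
    have hgf : g (algebraMap R _ f) ≠ 0 := fun h =>
      algebraMap_localization_ne_zero P hf (hg.injective (by rw [h, map_zero]))
    obtain ⟨e, he⟩ := hC.exists_splitting _ hgf
    obtain ⟨Φ, hΦ, hΦ1⟩ := he (e + 1) (Nat.le_succ e)
    rw [hgr] at hΦ1
    obtain ⟨y, hy, hyP⟩ := exists_notMem_frobeniusTraceIdeal p hS φ P n hns
      (isMaximalAdicCompletion_adicCompletion _) (e + 1) f Φ hΦ hΦ1
    exact hyP (hle (Ideal.mem_iSup_of_mem e hy))
  obtain ⟨e, φ', hφ', hφf⟩ := (Submodule.mem_iSup_of_directed _ hmono.directed_le).1 h2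
  exact ⟨e + 1, Nat.succ_pos e, φ', hφ', hφf⟩

/-- A direct summand of a regular ring of characteristic `p` has all the asserted properties. -/
theorem hochsterRoberts_of_split (p : ℕ) [Fact p.Prime] {R S : Type*} [CommRing R] [CommRing S]
    [CharP R p] [CharP S p] [Algebra R S] [IsRegularRing S] (φ : S →ₗ[R] R) (hφ : φ 1 = 1) :
    IsCohenMacaulayRing R ∧ IsNormalRing R ∧ (IsFFinite p S →
      HasFrobeniusSplittings p R ∧ (IsFFinite p R → IsStronglyFRegular p R)) := by
  have hCM := isCohenMacaulayRing_of_split p φ hφ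
  refine ⟨hCM, isNormalRing_of_split p φ hφ, fun hS => ?_⟩
  have hsplit := hasFrobeniusSplittings_of_split p hS φ hφ
  exact ⟨hsplit, fun hR => ⟨hCM.isNoetherianRing, hR, hsplit⟩⟩

/-! ### Representations and invariant functionals -/

section

variable {k H V S : Type*} [Field k] [CommRing H] [HopfAlgebra k H] [AddCommGroup V] [Module k V]
  [AddCommGroup S] [Module k S]

/-- `ℓ ⊗ id : V ⊗ H → k ⊗ H = H`. -/
def formContraction (H : Type*) [CommRing H] [HopfAlgebra k H] (ℓ : V →ₗ[k] k) : V ⊗[k] H →ₗ[k] H :=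
  (TensorProduct.lid k H).toLinearMap ∘ₗ ℓ.rTensor H

@[simp]
theorem formContraction_tmul (ℓ : V →ₗ[k] k) (v : V) (h : H) :
    formContraction H ℓ (v ⊗ₜ h) = ℓ v • h := by
  simp [formContraction]

theorem formContraction_rTensor (ℓ : S →ₗ[k] k) (j : V →ₗ[k] S) (x : V ⊗[k] H) :
    formContraction H ℓ (j.rTensor H x) = formContraction H (ℓ ∘ₗ j) x := by
  simp [formContraction, LinearMap.rTensor_comp]

theorem formContraction_injective {ℓ : V →ₗ[k] k} (h : Function.Injective ℓ) :
    Function.Injective (formContraction H ℓ) :=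
  (TensorProduct.lid k H).injective.comp (Module.Flat.rTensor_preserves_injective_linearMap ℓ h)

/-- The linear form `ℓ`, restricted to `W`, is invariant. -/
def IsInvariantOn (ρ : V →ₗ[k] V ⊗[k] H) (ℓ : V →ₗ[k] k) (W : Submodule k V) : Prop :=
  ∀ w ∈ W, formContraction H ℓ (ρ w) = ℓ w • (1 : H)

/-- Every invariant linear form on `W` vanishes; linear forms on `W` are encoded as restrictions of
linear forms on the ambient space. -/
def HasNoInvariantForms (ρ : V →ₗ[k] V ⊗[k] H) (W : Submodule k V) : Prop :=
  ∀ ℓ : V →ₗ[k] k, IsInvariantOn ρ ℓ W → ∀ w ∈ W, ℓ w = 0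

theorem HasNoInvariantForms.sup {ρ : V →ₗ[k] V ⊗[k] H} {W W' : Submodule k V}
    (h : HasNoInvariantForms ρ W) (h' : HasNoInvariantForms ρ W') :
    HasNoInvariantForms ρ (W ⊔ W') := by
  intro ℓ hℓ w hw
  obtain ⟨x, hx, y, hy, rfl⟩ := Submodule.mem_sup.1 hw
  rw [map_add, h ℓ (fun z hz => hℓ z (Submodule.mem_sup_left hz)) x hx,
    h' ℓ (fun z hz => hℓ z (Submodule.mem_sup_right hz)) y hy, add_zero]

theorem range_rTensor_subtype_mono {W W' : Submodule k V} (h : W ≤ W') :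
    LinearMap.range (W.subtype.rTensor H) ≤ LinearMap.range (W'.subtype.rTensor H) := by
  rw [← Submodule.subtype_comp_inclusion W W' h, LinearMap.rTensor_comp]
  exact LinearMap.range_comp_le_range _ _

theorem IsSubrep.sup {ρ : V →ₗ[k] V ⊗[k] H} {W W' : Submodule k V}
    (h : IsSubrep ρ W) (h' : IsSubrep ρ W') : IsSubrep ρ (W ⊔ W') := by
  intro w hw
  obtain ⟨x, hx, y, hy, rfl⟩ := Submodule.mem_sup.1 hw
  rw [map_add]
  exact add_mem (range_rTensor_subtype_mono le_sup_left (h x hx))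
    (range_rTensor_subtype_mono le_sup_right (h' y hy))

theorem IsSubrep.map {ρ : V →ₗ[k] V ⊗[k] H} {σ : S →ₗ[k] S ⊗[k] H} {j : V →ₗ[k] S}
    (hj : ∀ v, σ (j v) = j.rTensor H (ρ v)) {W : Submodule k V} (h : IsSubrep ρ W) :
    IsSubrep σ (W.map j) := by
  rintro _ ⟨w, hw, rfl⟩
  obtain ⟨x, hx⟩ := h w hw
  have hcomm : j ∘ₗ W.subtype = (W.map j).subtype ∘ₗ j.submoduleMap W := rfl
  rw [hj, ← hx, ← LinearMap.rTensor_comp_apply, hcomm, LinearMap.rTensor_comp_apply]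
  exact ⟨_, rfl⟩

theorem HasNoInvariantForms.map {ρ : V →ₗ[k] V ⊗[k] H} {σ : S →ₗ[k] S ⊗[k] H} {j : V →ₗ[k] S}
    (hj : ∀ v, σ (j v) = j.rTensor H (ρ v)) {W : Submodule k V} (h : HasNoInvariantForms ρ W) :
    HasNoInvariantForms σ (W.map j) := by
  rintro ℓ hℓ _ ⟨w, hw, rfl⟩
  refine h (ℓ ∘ₗ j) (fun v hv => ?_) w hw
  rw [← formContraction_rTensor, ← hj]
  exact hℓ _ ⟨v, hv, rfl⟩

theorem isSubrep_span_singleton {ρ : V →ₗ[k] V ⊗[k] H} {u : V} (hu : ρ u = u ⊗ₜ 1) :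
    IsSubrep ρ (k ∙ u) := by
  intro w hw
  obtain ⟨c, rfl⟩ := Submodule.mem_span_singleton.1 hw
  rw [map_smul, hu]
  exact Submodule.smul_mem _ _ ⟨⟨u, Submodule.mem_span_singleton_self u⟩ ⊗ₜ 1, by simp⟩

/-- An irreducible representation with a nonzero invariant linear form is trivial, because the form
is injective on it. -/
theorem IsIrreducibleSubrep.trivial_or_hasNoInvariantForms {ρ : V →ₗ[k] V ⊗[k] H}
    {W : Submodule k V} (h : IsIrreducibleSubrep ρ W) :
    (∀ w ∈ W, ρ w = w ⊗ₜ 1) ∨ HasNoInvariantForms ρ W := by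
  by_cases hW : HasNoInvariantForms ρ W
  · exact Or.inr hW
  left
  simp only [HasNoInvariantForms, not_forall] at hW
  obtain ⟨ℓ, hℓ, w₀, hw₀, hne⟩ := hW
  have hsub : IsSubrep ρ (W ⊓ LinearMap.ker ℓ) := by
    rintro w ⟨hw, hw0⟩
    obtain ⟨x, hx⟩ := h.isSubrep w hw
    have hx0 : (ℓ ∘ₗ W.subtype).rTensor H x = 0 := by
      refine (TensorProduct.lid k H).injective ?_
      have h1 := hℓ w hw
      rw [← hx, formContraction_rTensor, show ℓ w = 0 from hw0, zero_smul] at h1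
      rw [map_zero]
      exact h1
    obtain ⟨y, hy⟩ := (Module.Flat.rTensor_exact H
      (LinearMap.exact_subtype_ker_map (ℓ ∘ₗ W.subtype)) x).1 hx0
    let i : LinearMap.ker (ℓ ∘ₗ W.subtype) →ₗ[k] (W ⊓ LinearMap.ker ℓ : Submodule k V) :=
      LinearMap.codRestrict _ (W.subtype ∘ₗ Submodule.subtype _) fun z => ⟨z.1.2, z.2⟩
    refine ⟨i.rTensor H y, ?_⟩
    rw [← hx, ← hy, ← LinearMap.rTensor_comp_apply, ← LinearMap.rTensor_comp_apply]
    rfl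
  have hbot : W ⊓ LinearMap.ker ℓ = ⊥ := by
    refine (h.eq_bot_or_eq _ inf_le_left hsub).resolve_right fun h1 => hne ?_
    exact (h1.ge hw₀).2
  have hinj : Function.Injective (ℓ ∘ₗ W.subtype) := by
    rw [← LinearMap.ker_eq_bot, LinearMap.ker_eq_bot']
    intro w hw
    have : (w : V) ∈ W ⊓ LinearMap.ker ℓ := ⟨w.2, hw⟩
    rw [hbot, Submodule.mem_bot] at this
    exact Subtype.ext this
  intro w hw
  obtain ⟨x, hx⟩ := h.isSubrep w hw
  have h2 : x = (⟨w, hw⟩ : W) ⊗ₜ 1 := by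
    refine formContraction_injective hinj ?_
    rw [← formContraction_rTensor, hx, hℓ w hw, formContraction_tmul]
    rfl
  rw [← hx, h2]
  simp

/-- The projections onto the summands of a direct sum decomposition, as endomorphisms. -/
theorem exists_projections {n : ℕ} {W : Fin n → Submodule k V} (hW : iSupIndep W)
    (htop : ⨆ i, W i = ⊤) : ∃ P : Fin n → V →ₗ[k] V, (∀ i v, P i v ∈ W i) ∧
      (∀ i, ∀ w ∈ W i, P i w = w) ∧ (∀ i j, i ≠ j → ∀ w ∈ W j, P i w = 0) ∧
      ∀ v, ∑ i, P i v = v := by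
  classical
  have hint := DirectSum.isInternal_submodule_of_iSupIndep_of_iSup_eq_top hW htop
  let e := LinearEquiv.ofBijective (DirectSum.coeLinearMap W) hint
  have he : ∀ j (w : W j), e.symm w = DirectSum.lof k (Fin n) (fun i => W i) j w := by
    intro j w
    rw [LinearEquiv.symm_apply_eq]
    exact (DirectSum.coeLinearMap_lof W j w).symm
  let P : Fin n → V →ₗ[k] V := fun i =>
    (W i).subtype ∘ₗ DirectSum.component k (Fin n) (fun i => W i) i ∘ₗ e.symm.toLinearMap
  have hP1 : ∀ i, ∀ w ∈ W i, P i w = w := by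
    intro i w hw
    have := he i ⟨w, hw⟩
    simp only [P, LinearMap.comp_apply, LinearEquiv.coe_coe]
    rw [this, DirectSum.component.lof_self]
    rfl
  have hP2 : ∀ i j, i ≠ j → ∀ w ∈ W j, P i w = 0 := by
    intro i j hij w hw
    have := he j ⟨w, hw⟩
    simp only [P, LinearMap.comp_apply, LinearEquiv.coe_coe]
    rw [this, DirectSum.component.of, dif_neg hij.symm, map_zero]
  refine ⟨P, fun i v => Subtype.property _, hP1, hP2, fun v => ?_⟩
  have hv : v ∈ ⨆ i, W i := htop ▸ trivial
  induction hv using Submodule.iSup_induction' with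
  | mem j w hw =>
    rw [Finset.sum_eq_single j (fun i _ hij => hP2 i j hij w hw) (by simp), hP1 j w hw]
  | zero => simp
  | add x y _ _ hx hy => simp only [map_add, Finset.sum_add_distrib, hx, hy]

/-- The projections of a decomposition into subrepresentations are equivariant. -/
theorem rTensor_projection {ρ : V →ₗ[k] V ⊗[k] H} {n : ℕ} {W : Fin n → Submodule k V}
    (hρ : ∀ i, IsSubrep ρ (W i)) (htop : ⨆ i, W i = ⊤) {P : V →ₗ[k] V} {i : Fin n}
    (h1 : ∀ w ∈ W i, P w = w) (h2 : ∀ j, i ≠ j → ∀ w ∈ W j, P w = 0) (v : V) :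
    P.rTensor H (ρ v) = ρ (P v) := by
  have hv : v ∈ ⨆ i, W i := htop ▸ trivial
  induction hv using Submodule.iSup_induction' with
  | mem j w hw =>
    obtain ⟨x, hx⟩ := hρ j w hw
    rw [← hx, ← LinearMap.rTensor_comp_apply]
    by_cases hij : i = j
    · subst hij
      rw [h1 w hw, ← hx, show P ∘ₗ (W i).subtype = (W i).subtype from
        LinearMap.ext fun z => h1 z z.2]
    · rw [h2 j hij w hw, map_zero, show P ∘ₗ (W j).subtype = 0 from
        LinearMap.ext fun z => h2 j hij z z.2, LinearMap.rTensor_zero, LinearMap.zero_apply]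
  | zero => simp
  | add x y _ _ hx hy => simp only [map_add, hx, hy]

/-- In a direct sum of irreducible representations, invariant linear forms separate invariant
vectors from zero. -/
theorem exists_invariant_form_ne_zero {ρ : V →ₗ[k] V ⊗[k] H} {n : ℕ} {W : Fin n → Submodule k V}
    (hirr : ∀ i, IsIrreducibleSubrep ρ (W i)) (hW : iSupIndep W) (htop : ⨆ i, W i = ⊤) {v : V}
    (hv : ρ v = v ⊗ₜ 1) (hne : v ≠ 0) : ∃ ℓ : V →ₗ[k] k, IsInvariantOn ρ ℓ ⊤ ∧ ℓ v ≠ 0 := by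
  obtain ⟨P, hP, hP1, hP2, hsum⟩ := exists_projections hW htop
  obtain ⟨i, hi⟩ : ∃ i, P i v ≠ 0 := by
    by_contra! hall
    exact hne (by rw [← hsum v, Finset.sum_eq_zero fun i _ => hall i])
  have hPρ := rTensor_projection (fun i => (hirr i).isSubrep) htop (hP1 i) (hP2 i)
  have hu : ρ (P i v) = P i v ⊗ₜ 1 := by rw [← hPρ, hv, LinearMap.rTensor_tmul]
  have hspan : k ∙ P i v = W i := by
    refine ((hirr i).eq_bot_or_eq _ ?_ (isSubrep_span_singleton hu)).resolve_left ?_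
    · exact (Submodule.span_singleton_le_iff_mem _ _).2 (hP i v)
    · rwa [Submodule.span_singleton_eq_bot]
  obtain ⟨ℓ, hℓ⟩ := Module.Projective.exists_dual_ne_zero k hi
  refine ⟨ℓ ∘ₗ P i, fun w _ => ?_, hℓ⟩
  obtain ⟨c, hc⟩ := Submodule.mem_span_singleton.1 (hspan.ge (hP i w))
  rw [← formContraction_rTensor, hPρ, LinearMap.comp_apply, ← hc, map_smul, hu,
    TensorProduct.smul_tmul', formContraction_tmul]

end

/-! ### Local finiteness and the Reynolds operator -/

section

variable {k H S : Type*} [Field k] [CommRing H] [HopfAlgebra k H] [AddCommGroup S] [Module k S]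

/-- Every element lies in a finite-dimensional subrepresentation: the span of the coefficients of
`ρ s` with respect to a basis of `H`. -/
theorem IsCoaction.exists_finiteDimensional_isSubrep {ρ : S →ₗ[k] S ⊗[k] H}
    (h : IsCoaction k H S ρ) (s : S) :
    ∃ W : Submodule k S, FiniteDimensional k W ∧ IsSubrep ρ W ∧ s ∈ W := by
  classical
  let b := Module.Free.chooseBasis k H
  let c := TensorProduct.equivFinsuppOfBasisRight b (ρ s)
  have hc : ρ s = c.sum fun i m => m ⊗ₜ b i := by
    rw [← TensorProduct.equivFinsuppOfBasisRight_symm_apply, LinearEquiv.symm_apply_apply]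
  have hmem : ∀ i ∈ c.support, c i ∈ Submodule.span k (c '' c.support) := fun i hi =>
    Submodule.subset_span ⟨i, hi, rfl⟩
  set W := Submodule.span k (c '' c.support) with hW
  have hρs : ρ s ∈ LinearMap.range (W.subtype.rTensor H) := by
    rw [hc, Finsupp.sum]
    exact sum_mem fun i hi => ⟨⟨c i, hmem i hi⟩ ⊗ₜ b i, by simp⟩
  refine ⟨W, FiniteDimensional.span_of_finite k (c.support.finite_toSet.image c), ?_, ?_⟩
  · intro w hw
    induction hw using Submodule.span_induction with
    | zero => rw [map_zero]; exact zero_mem _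
    | add x y _ _ hx hy => rw [map_add]; exact add_mem hx hy
    | smul a x _ hx => rw [map_smul]; exact Submodule.smul_mem _ _ hx
    | mem x hx =>
      obtain ⟨i, -, rfl⟩ := hx
      -- by coassociativity `ρ (c i) = (id ⊗ g) (ρ s)`
      -- where `g` is `Δ` followed by the `i`-th coordinate of the second factor
      let g : H →ₗ[k] H := (TensorProduct.rid k H).toLinearMap ∘ₗ (b.coord i).lTensor H ∘ₗ
        Coalgebra.comul (R := k) (A := H)
      have h1 : ∀ x : S ⊗[k] H, ρ (TensorProduct.rid k S ((b.coord i).lTensor S x)) =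
          TensorProduct.rid k (S ⊗[k] H) ((b.coord i).lTensor (S ⊗[k] H) (ρ.rTensor H x)) := by
        intro x
        induction x with
        | zero => simp
        | add x y hx hy => simp only [map_add, hx, hy]
        | tmul x y => simp
      have h2 : ∀ (x : S) (y : H ⊗[k] H), TensorProduct.rid k (S ⊗[k] H)
          ((b.coord i).lTensor (S ⊗[k] H) ((TensorProduct.assoc k S H H).symm (x ⊗ₜ y))) =
          x ⊗ₜ TensorProduct.rid k H ((b.coord i).lTensor H y) := by
        intro x y
        induction y with
        | zero => simp
        | add y z hy hz => simp only [map_add, TensorProduct.tmul_add, hy, hz]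
        | tmul y z => simp
      have h3 : ∀ x : S ⊗[k] H, TensorProduct.rid k (S ⊗[k] H)
          ((b.coord i).lTensor (S ⊗[k] H) ((TensorProduct.assoc k S H H).symm
            ((Coalgebra.comul (R := k) (A := H)).lTensor S x))) = g.lTensor S x := by
        intro x
        induction x with
        | zero => simp
        | add x y hx hy => simp only [map_add, hx, hy]
        | tmul x y => rw [LinearMap.lTensor_tmul, h2]; rfl
      have h4 : ρ.rTensor H (ρ s) = (TensorProduct.assoc k S H H).symm
          ((Coalgebra.comul (R := k) (A := H)).lTensor S (ρ s)) := by
        rw [LinearEquiv.eq_symm_apply]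
        exact LinearMap.congr_fun h.coassoc s
      have h5 : ρ (c i) = g.lTensor S (ρ s) := by
        rw [← h3, ← h4, ← h1, ← TensorProduct.equivFinsuppOfBasisRight_apply]
      obtain ⟨x, hx⟩ := hρs
      rw [h5, ← hx, ← LinearMap.comp_apply, LinearMap.lTensor_comp_rTensor,
        ← LinearMap.rTensor_comp_lTensor]
      exact ⟨_, rfl⟩
  · have h1 := LinearMap.congr_fun h.counit s
    simp only [LinearMap.comp_apply, LinearMap.id_apply, LinearEquiv.coe_coe] at h1
    rw [← h1, hc, Finsupp.sum, map_sum, map_sum]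
    refine sum_mem fun i hi => ?_
    rw [LinearMap.lTensor_tmul, TensorProduct.rid_tmul]
    exact Submodule.smul_mem _ _ (hmem i hi)

/-- Any injective linear map onto a subrepresentation pulls the coaction back. -/
theorem IsCoaction.exists_comap {V : Type*} [AddCommGroup V] [Module k V] {ρ : S →ₗ[k] S ⊗[k] H}
    (h : IsCoaction k H S ρ) {j : V →ₗ[k] S} (hj : Function.Injective j)
    (hW : IsSubrep ρ (LinearMap.range j)) :
    ∃ σ : V →ₗ[k] V ⊗[k] H, IsCoaction k H V σ ∧ ∀ v, ρ (j v) = j.rTensor H (σ v) := by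
  have hjH : Function.Injective (j.rTensor H) :=
    Module.Flat.rTensor_preserves_injective_linearMap j hj
  have hjHH : Function.Injective (j.rTensor (H ⊗[k] H)) :=
    Module.Flat.rTensor_preserves_injective_linearMap j hj
  have hmem : ∀ v, ρ (j v) ∈ LinearMap.range (j.rTensor H) := by
    intro v
    obtain ⟨x, hx⟩ := hW (j v) ⟨v, rfl⟩
    obtain ⟨y, rfl⟩ := LinearMap.rTensor_surjective H j.surjective_rangeRestrict x
    rw [← hx, ← LinearMap.rTensor_comp_apply]
    exact ⟨y, rfl⟩
  let σ : V →ₗ[k] V ⊗[k] H := (LinearEquiv.ofInjective _ hjH).symm.toLinearMap ∘ₗ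
    LinearMap.codRestrict _ (ρ ∘ₗ j) hmem
  have hσ : ∀ v, ρ (j v) = j.rTensor H (σ v) := fun v =>
    (congrArg Subtype.val ((LinearEquiv.ofInjective _ hjH).apply_symm_apply ⟨_, hmem v⟩)).symm
  refine ⟨σ, ⟨LinearMap.ext fun v => hjHH ?_, LinearMap.ext fun v => hj ?_⟩, hσ⟩
  · have h1 := LinearMap.congr_fun h.coassoc (j v)
    simp only [LinearMap.comp_apply, LinearEquiv.coe_coe, hσ] at h1 ⊢
    rw [← LinearMap.rTensor_comp_apply, show ρ ∘ₗ j = j.rTensor H ∘ₗ σ from LinearMap.ext hσ,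
      LinearMap.rTensor_comp_apply] at h1
    have h2 : ∀ x : (V ⊗[k] H) ⊗[k] H, TensorProduct.assoc k S H H ((j.rTensor H).rTensor H x) =
        j.rTensor (H ⊗[k] H) (TensorProduct.assoc k V H H x) := by
      intro x
      rw [LinearMap.rTensor_tensor]
      simp
    rw [h2] at h1
    have h3 : ∀ x : V ⊗[k] H, (Coalgebra.comul (R := k) (A := H)).lTensor S (j.rTensor H x) =
        j.rTensor (H ⊗[k] H) ((Coalgebra.comul (R := k) (A := H)).lTensor V x) := by
      intro x
      induction x with
      | zero => simp
      | add x y hx hy => simp only [map_add, hx, hy]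
      | tmul x y => simp
    rw [h1, h3]
  · have h1 := LinearMap.congr_fun h.counit (j v)
    simp only [LinearMap.comp_apply, LinearEquiv.coe_coe, LinearMap.id_apply, hσ] at h1 ⊢
    rw [← h1]
    have h2 : ∀ x : V ⊗[k] H, j (TensorProduct.rid k V
        ((Coalgebra.counit (R := k) (A := H)).lTensor V x)) = TensorProduct.rid k S
        ((Coalgebra.counit (R := k) (A := H)).lTensor S (j.rTensor H x)) := by
      intro x
      induction x with
      | zero => simp
      | add x y hx hy => simp only [map_add, hx, hy]
      | tmul x y => simp
    exact h2 _

end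

section

variable {k : Type u} {H S : Type*} [Field k] [CommRing H] [HopfAlgebra k H]

/-- A finite-dimensional subrepresentation of a representation of a linearly reductive group is
the image of a direct sum of irreducible representations. -/
theorem IsLinearlyReductive.exists_model (hG : IsLinearlyReductive k H) [AddCommGroup S]
    [Module k S] {ρ : S →ₗ[k] S ⊗[k] H} (h : IsCoaction k H S ρ) (W : Submodule k S)
    [FiniteDimensional k W] (hW : IsSubrep ρ W) :
    ∃ (m : ℕ) (j : (Fin m → k) →ₗ[k] S) (σ : (Fin m → k) →ₗ[k] (Fin m → k) ⊗[k] H) (n : ℕ)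
      (U : Fin n → Submodule k (Fin m → k)), Function.Injective j ∧ LinearMap.range j = W ∧
      (∀ v, ρ (j v) = j.rTensor H (σ v)) ∧ (∀ i, IsIrreducibleSubrep σ (U i)) ∧ iSupIndep U ∧
      ⨆ i, U i = ⊤ := by
  let e := (Module.finBasis k W).equivFun.symm
  let j := W.subtype ∘ₗ e.toLinearMap
  have hj : Function.Injective j := W.injective_subtype.comp e.injective
  have hr : LinearMap.range j = W := by
    rw [LinearMap.range_comp, LinearEquiv.range, Submodule.map_top, Submodule.range_subtype]
  obtain ⟨σ, hσ, hjσ⟩ := h.exists_comap hj (hr.symm ▸ hW)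
  obtain ⟨n, U, hU, hind, htop⟩ := hG.completelyReducible _ σ hσ
  exact ⟨_, j, σ, n, U, hj, hr, hjσ, hU, hind, htop⟩

variable [CommRing S] [Algebra k S]

theorem mem_invariantRing_iff (ρ : S →ₐ[k] S ⊗[k] H) (s : S) :
    s ∈ invariantRing ρ ↔ ρ s = s ⊗ₜ 1 := Iff.rfl

/-- The sum of all finite-dimensional subrepresentations of `S` without invariant linear forms; it
is a module over the ring of invariants since multiplication by an invariant is equivariant. -/
def nonInvariantPart (ρ : S →ₐ[k] S ⊗[k] H) : Submodule (invariantRing ρ) S where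
  carrier := {s | ∃ W : Submodule k S, FiniteDimensional k W ∧ IsSubrep ρ.toLinearMap W ∧
    HasNoInvariantForms ρ.toLinearMap W ∧ s ∈ W}
  zero_mem' := by
    refine ⟨⊥, inferInstance, fun w hw => ?_, fun ℓ _ w hw => ?_, zero_mem _⟩
    · rw [(Submodule.mem_bot k).1 hw, map_zero]
      exact zero_mem _
    · rw [(Submodule.mem_bot k).1 hw, map_zero]
  add_mem' := by
    rintro x y ⟨W, _, h2, h3, h4⟩ ⟨W', _, h2', h3', h4'⟩
    exact ⟨W ⊔ W', inferInstance, h2.sup h2', h3.sup h3',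
      add_mem (Submodule.mem_sup_left h4) (Submodule.mem_sup_right h4')⟩
  smul_mem' := by
    rintro a x ⟨W, _, h2, h3, h4⟩
    have hj : ∀ v, ρ.toLinearMap (LinearMap.mulLeft k (a : S) v) =
        (LinearMap.mulLeft k (a : S)).rTensor H (ρ.toLinearMap v) := by
      intro v
      have : ∀ y : S ⊗[k] H, ((a : S) ⊗ₜ 1) * y = (LinearMap.mulLeft k (a : S)).rTensor H y := by
        intro y
        induction y with
        | zero => simp
        | add x y hx hy => simp only [map_add, mul_add, hx, hy]
        | tmul x y => simp
      rw [← this, ← (mem_invariantRing_iff ρ a).1 a.2]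
      simp
    exact ⟨W.map (LinearMap.mulLeft k (a : S)), inferInstance, h2.map hj, h3.map hj, x, h4, rfl⟩

/-- As a module over the ring of invariants, `S` is the direct sum of that ring and the
non-invariant part. Invariant linear forms separate invariant vectors from zero, so the intersection
is zero; an irreducible representation is trivial or has no invariant linear forms, so the sum is
everything. -/
theorem IsLinearlyReductive.isCompl_nonInvariantPart (hG : IsLinearlyReductive k H)
    {ρ : S →ₐ[k] S ⊗[k] H} (hρ : IsCoaction k H S ρ.toLinearMap) :
    IsCompl (LinearMap.range (Algebra.linearMap (invariantRing ρ) S)) (nonInvariantPart ρ) := by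
  refine IsCompl.of_eq ?_ ?_
  · rw [eq_bot_iff]
    rintro _ ⟨⟨s, rfl⟩, W, _, hW, hform, hs⟩
    obtain ⟨m, j, σ, n, U, hj, hr, hjσ, hU, hind, htop⟩ := hG.exists_model hρ W hW
    rw [← hr] at hs
    obtain ⟨v, hv⟩ := hs
    rw [Submodule.mem_bot, ← hv]
    by_contra hne
    have hvσ : σ v = v ⊗ₜ 1 := by
      refine Module.Flat.rTensor_preserves_injective_linearMap (M := H) j hj ?_
      rw [← hjσ, hv, LinearMap.rTensor_tmul, hv]
      exact (mem_invariantRing_iff ρ s).1 s.2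
    obtain ⟨ℓ, hℓ, hℓv⟩ := exists_invariant_form_ne_zero hU hind htop hvσ
      (fun h0 => hne (by rw [h0, map_zero]))
    obtain ⟨r, hrj⟩ := LinearMap.exists_leftInverse_of_injective j (LinearMap.ker_eq_bot.2 hj)
    have hlj : (ℓ ∘ₗ r) ∘ₗ j = ℓ := by rw [LinearMap.comp_assoc, hrj, LinearMap.comp_id]
    refine hℓv ?_
    rw [← LinearMap.congr_fun hlj v]
    refine hform (ℓ ∘ₗ r) ?_ (j v) (hr ▸ ⟨v, rfl⟩)
    rw [← hr]
    rintro _ ⟨w, rfl⟩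
    rw [hjσ, formContraction_rTensor, hlj, hℓ w trivial, ← LinearMap.comp_apply, hlj]
  · rw [eq_top_iff]
    rintro s -
    obtain ⟨W, _, hW, hs⟩ := hρ.exists_finiteDimensional_isSubrep s
    obtain ⟨m, j, σ, n, U, hj, hr, hjσ, hU, hind, htop⟩ := hG.exists_model hρ W hW
    rw [← hr] at hs
    obtain ⟨v, rfl⟩ := hs
    have hv : v ∈ ⨆ i, U i := htop ▸ trivial
    induction hv using Submodule.iSup_induction' with
    | mem i w hw =>
      rcases (hU i).trivial_or_hasNoInvariantForms with h | h
      · refine Submodule.mem_sup_left ⟨⟨j w, ?_⟩, rfl⟩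
        rw [mem_invariantRing_iff]
        refine (hjσ w).trans ?_
        rw [h w hw, LinearMap.rTensor_tmul]
      · exact Submodule.mem_sup_right ⟨(U i).map j, inferInstance, (hU i).isSubrep.map hjσ,
          h.map hjσ, w, hw, rfl⟩
    | zero => rw [map_zero]; exact zero_mem _
    | add x y _ _ hx hy => rw [map_add]; exact add_mem hx hy

/-- The Reynolds operator: the ring of invariants of a linearly reductive group is a direct
summand. -/
theorem IsLinearlyReductive.exists_reynolds (hG : IsLinearlyReductive k H)
    {ρ : S →ₐ[k] S ⊗[k] H} (hρ : IsCoaction k H S ρ.toLinearMap) :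
    ∃ φ : S →ₗ[invariantRing ρ] invariantRing ρ, φ 1 = 1 := by
  have hinj : Function.Injective (Algebra.linearMap (invariantRing ρ) S) :=
    Subtype.val_injective
  refine ⟨(LinearEquiv.ofInjective _ hinj).symm.toLinearMap ∘ₗ
    Submodule.projectionOnto _ _ (hG.isCompl_nonInvariantPart hρ), ?_⟩
  rw [LinearMap.comp_apply, LinearEquiv.coe_coe, LinearEquiv.symm_apply_eq]
  exact Submodule.projectionOnto_apply_left (hG.isCompl_nonInvariantPart hρ) ⟨1, 1, rfl⟩

end

/-- Hochster-Roberts in prime characteristic: first for an arbitrary split ring map `R → S` with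
`S` regular, then for the ring of invariants of a linearly reductive group acting on `S`. -/
theorem mainTheorem1 (p : ℕ) [Fact p.Prime] :
    (∀ (R S : Type*) [CommRing R] [CommRing S] [CharP R p] [CharP S p] [Algebra R S]
      [IsRegularRing S], (∃ φ : S →ₗ[R] R, φ 1 = 1) →
        IsCohenMacaulayRing R ∧ IsNormalRing R ∧
        (IsFFinite p S →
          HasFrobeniusSplittings p R ∧ (IsFFinite p R → IsStronglyFRegular p R))) ∧
    (∀ (k : Type u) (H S : Type*) [Field k] [CommRing H] [HopfAlgebra k H]
      [CommRing S] [Algebra k S] [CharP S p] [IsRegularRing S],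
      IsLinearlyReductive k H →
      ∀ ρ : S →ₐ[k] S ⊗[k] H, IsCoaction k H S ρ.toLinearMap →
        IsCohenMacaulayRing (invariantRing ρ) ∧ IsNormalRing (invariantRing ρ) ∧
        (IsFFinite p S →
          HasFrobeniusSplittings p (invariantRing ρ) ∧
          (IsFFinite p (invariantRing ρ) → IsStronglyFRegular p (invariantRing ρ)))) :=
  ⟨fun _ _ _ _ _ _ _ _ ⟨φ, hφ⟩ => hochsterRoberts_of_split p φ hφ,
    fun _ _ _ _ _ _ _ _ _ _ hG _ hρ =>
      have ⟨φ, hφ⟩ := hG.exists_reynolds hρ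
      hochsterRoberts_of_split p φ hφ⟩
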